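/- **Setting.** Let $\Omega\subset\mathbb R^d$ be a bounded connected open set and let $\rho$ be a measurable function with $0<m\le\rho(x)\le M$ for all $x\in\Omega$ and $\int_\Omega\rho\,dx=1$. Let $\phi=\frac1{\mathcal V_d}\mathbf 1_{B(0,1)}$, where $B(0,1)$ is the open Euclidean unit ball of $\mathbb R^d$ and $\mathcal V_d$ its volume. For $h>0$ put $$k_h(x,y)=h^{-d}\phi\Big(\frac{x-y}h\Big)\min\Big(\frac{\rho(y)}{\rho(x)},1\Big),\qquad m_h(x)=1-\int_\Omega k_h(x,y)\,dy,$$ and let $T_h$ be the bounded operator on $L^2(\Omega,\rho\,dx;\mathbb C)$ given by $$T_hu(x)=m_h(x)u(x)+\int_\Omega k_h(x,y)u(y)\,dy .$$ Write $\sigma(T_h)$ for its spectrum and $\sigma_{ess}(T_h)$ for its essential spectrum, i.e. the set of $z\in\mathbb C$ such that $z-T_h$ is not Fredholm. **Assumption 1.** There is a finite collection of open sets $(\omega_i)_{i\in I_r\cup I_c}$ of $\mathbb R^d$ with $\partial\Omega\subset\bigcup_{i}\omega_i$ such that: (i) for $i\in I_r$, $\partial\Omega\cap\omega_i$ has Lipschitz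 regularity: near each point of $\partial\Omega\cap\omega_i$, in suitable orthonormal coordinates, $\Omega$ is the set of points strictly above the graph of a Lipschitz function; (ii) for $i\in I_c$, there are integers $d_i',d_i''\ge0$ with $1+d_i'+d_i''=d$, a closed smooth submanifold $S_i$ of $\mathbb R^d$ of dimension $d_i''$, and $\alpha_i>1$, $r_i>0$, $\epsilon_i>0$, such that around every point $p\in S_i$ there is a smooth coordinate system $(x_1,x',x'')\in\mathbb R\times\mathbb R^{d_i'}\times\mathbb R^{d_i''}$, defined on an open neighbourhood $W_p$ of $p$, in which $p=(0,0,0)$ and $\Omega\cap\omega_i$ is given within $W_p$ by $$0<x_1<\epsilon_i,\qquad |x'|<x_1^{\alpha_i},\qquad |x''|<r_i$$ (Euclidean norms); moreover these coordinate neighbourhoods cover $\partial\Omega\cap\omega_i$, that is, $\partial\Omega\cap\omega_i\subset\bigcup_{p\in S_i}W_p$. Put $\gamma=\max_{i\in I_c}(\alpha_i-1)d_i'$, with $\gamma=0$ if $I_c=\emptyset$. **Proposition 1.3.** Under Assumption 1, there exist $\delta_1,\delta_2>0$ and $h_0>0$ such that for all $h\in(0,h_0]$, $$\sigma(T_h)\subset[-1+\delta_1h^\gamma,\,1]\qquad\text{and}\qquad\sigma_{ess}(T_h)\subset[-1+\delta_1h^\gamma,\,1-\delta_2h^\gamma].$$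 -/

import Mathlib

open MeasureTheory Set Filter
open scoped ENNReal NNReal

noncomputable section

/-! ### The Metropolis kernel and the Metropolis operator -/

/-- The function `φ = 𝟙_{B(0,1)} / vol B(0,1)` on `ℝᵈ`, with `B(0,1)` the open Euclidean unit
ball. -/
def ballProfile {d : ℕ} (z : EuclideanSpace ℝ (Fin d)) : ℝ :=
  (Metric.ball (0 : EuclideanSpace ℝ (Fin d)) 1).indicator
    (fun _ => (volume.real (Metric.ball (0 : EuclideanSpace ℝ (Fin d)) 1))⁻¹) z

/-- The proposal kernel `k_{h,ρ}(x,y) = h^{-d} φ((x-y)/h) min(ρ(y)/ρ(x), 1)`. -/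
def metropolisKernel {d : ℕ} (ρ : EuclideanSpace ℝ (Fin d) → ℝ) (h : ℝ)
    (x y : EuclideanSpace ℝ (Fin d)) : ℝ :=
  (h ^ d)⁻¹ * ballProfile (h⁻¹ • (x - y)) * min (ρ y / ρ x) 1

/-- The holding probability `m_{h,ρ}(x) = 1 - ∫_Ω k_{h,ρ}(x,y) dy`. -/
def holdingProb {d : ℕ} (Ω : Set (EuclideanSpace ℝ (Fin d))) (ρ : EuclideanSpace ℝ (Fin d) → ℝ)
    (h : ℝ) (x : EuclideanSpace ℝ (Fin d)) : ℝ :=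
  1 - ∫ y in Ω, metropolisKernel ρ h x y

/-- The formula `x ↦ m_{h,ρ}(x) u(x) + ∫_Ω k_{h,ρ}(x,y) u(y) dy`, on functions. -/
def metropolisAction {d : ℕ} (Ω : Set (EuclideanSpace ℝ (Fin d)))
    (ρ : EuclideanSpace ℝ (Fin d) → ℝ) (h : ℝ) (u : EuclideanSpace ℝ (Fin d) → ℂ)
    (x : EuclideanSpace ℝ (Fin d)) : ℂ :=
  (holdingProb Ω ρ h x : ℂ) * u x + ∫ y in Ω, (metropolisKernel ρ h x y : ℂ) * u y

/-- A bounded connected open set `Ω ⊆ ℝᵈ` with a measurable density `ρ`, `0 < m ≤ ρ ≤ M` on `Ω`,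
such that `∫_Ω ρ = 1`. Only the values of `ρ` on `Ω` matter. -/
structure MetropolisSetting (d : ℕ) where
  /-- the domain -/
  Ω : Set (EuclideanSpace ℝ (Fin d))
  /-- the density -/
  ρ : EuclideanSpace ℝ (Fin d) → ℝ
  /-- the lower bound of the density -/
  m : ℝ
  /-- the upper bound of the density -/
  M : ℝ
  isOpen : IsOpen Ω
  isBounded : Bornology.IsBounded Ω
  isConnected : IsConnected Ω
  aemeasurable : AEMeasurable ρ (volume.restrict Ω)
  m_pos : 0 < m
  m_le : ∀ x ∈ Ω, m ≤ ρ x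
  le_M : ∀ x ∈ Ω, ρ x ≤ M
  normalized : ∫⁻ x in Ω, ENNReal.ofReal (ρ x) = 1

namespace MetropolisSetting

variable {d : ℕ} (P : MetropolisSetting d)

/-- The probability measure `dμ_ρ = ρ(x) dx` on `Ω`. -/
def μ : Measure (EuclideanSpace ℝ (Fin d)) :=
  (volume.restrict P.Ω).withDensity fun x => ENNReal.ofReal (P.ρ x)

instance : IsProbabilityMeasure P.μ :=
  ⟨by rw [μ, withDensity_apply _ MeasurableSet.univ, setLIntegral_univ]; exact P.normalized⟩

instance : IsFiniteMeasure (volume.restrict P.Ω) :=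
  ⟨by rw [Measure.restrict_apply_univ]; exact P.isBounded.measure_lt_top⟩

theorem μ_ac : P.μ ≪ volume.restrict P.Ω := withDensity_absolutelyContinuous _ _

theorem smul_le_μ : ENNReal.ofReal P.m • volume.restrict P.Ω ≤ P.μ := by
  rw [← withDensity_const]
  apply withDensity_mono
  filter_upwards [ae_restrict_mem P.isOpen.measurableSet] with x hx
  exact ENNReal.ofReal_le_ofReal (P.m_le x hx)

theorem le_smul_μ : volume.restrict P.Ω ≤ (ENNReal.ofReal P.m)⁻¹ • P.μ := by
  have h0 : ENNReal.ofReal P.m ≠ 0 := by simp [P.m_pos]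
  have hle := P.smul_le_μ
  intro s
  have hs := hle s
  simp only [Measure.smul_apply, smul_eq_mul] at hs ⊢
  rw [mul_comm] at hs
  rw [mul_comm, ← div_eq_mul_inv]
  exact (ENNReal.le_div_iff_mul_le (Or.inl h0) (Or.inl ENNReal.ofReal_ne_top)).2 hs

theorem inv_m_ne_top : (ENNReal.ofReal P.m)⁻¹ ≠ ∞ := by
  simp [P.m_pos]

theorem ac_μ : volume.restrict P.Ω ≪ P.μ :=
  Measure.absolutelyContinuous_of_le_smul P.le_smul_μ

/-- A bound of the kernel, uniform in `x, y`. -/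
def kernelBound (d : ℕ) (h : ℝ) : ℝ :=
  |(h ^ d)⁻¹| * (volume.real (Metric.ball (0 : EuclideanSpace ℝ (Fin d)) 1))⁻¹

theorem kernelBound_nonneg (d : ℕ) (h : ℝ) : 0 ≤ kernelBound d h := by
  unfold kernelBound; positivity

theorem abs_kernel_le (h : ℝ) {x y : EuclideanSpace ℝ (Fin d)} (hx : x ∈ P.Ω) (hy : y ∈ P.Ω) :
    |metropolisKernel P.ρ h x y| ≤ kernelBound d h := by
  have hx' := P.m_pos.trans_le (P.m_le x hx)
  have hy' := P.m_pos.trans_le (P.m_le y hy)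
  have h1 : |min (P.ρ y / P.ρ x) 1| ≤ 1 := by
    rw [abs_of_nonneg (le_min (by positivity) zero_le_one)]
    exact min_le_right _ _
  have h2 : |ballProfile (h⁻¹ • (x - y))| ≤
      (volume.real (Metric.ball (0 : EuclideanSpace ℝ (Fin d)) 1))⁻¹ := by
    have h0 : 0 ≤ (volume.real (Metric.ball (0 : EuclideanSpace ℝ (Fin d)) 1))⁻¹ := by positivity
    unfold ballProfile Set.indicator
    split_ifs
    · rw [abs_of_nonneg h0]
    · simp
  unfold metropolisKernel kernelBound
  rw [abs_mul, abs_mul]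
  calc _ ≤ |(h ^ d)⁻¹| * (volume.real (Metric.ball (0 : EuclideanSpace ℝ (Fin d)) 1))⁻¹ * 1 := by
        gcongr
    _ = _ := mul_one _

theorem aestronglyMeasurable_kernel (h : ℝ) :
    AEStronglyMeasurable (fun z : EuclideanSpace ℝ (Fin d) × EuclideanSpace ℝ (Fin d) =>
      metropolisKernel P.ρ h z.1 z.2) ((volume.restrict P.Ω).prod (volume.restrict P.Ω)) := by
  have hb : Measurable (ballProfile : EuclideanSpace ℝ (Fin d) → ℝ) :=
    measurable_const.indicator Metric.isOpen_ball.measurableSet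
  have h1 : AEMeasurable (fun z : EuclideanSpace ℝ (Fin d) × EuclideanSpace ℝ (Fin d) => P.ρ z.1)
      ((volume.restrict P.Ω).prod (volume.restrict P.Ω)) := P.aemeasurable.comp_fst
  have h2 : AEMeasurable (fun z : EuclideanSpace ℝ (Fin d) × EuclideanSpace ℝ (Fin d) => P.ρ z.2)
      ((volume.restrict P.Ω).prod (volume.restrict P.Ω)) := P.aemeasurable.comp_snd
  have h3 : Measurable (fun z : EuclideanSpace ℝ (Fin d) × EuclideanSpace ℝ (Fin d) =>
      ballProfile (h⁻¹ • (z.1 - z.2))) :=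
    hb.comp ((measurable_fst.sub measurable_snd).const_smul h⁻¹)
  exact (((h3.const_mul _).aemeasurable).mul ((h2.div h1).min aemeasurable_const)).aestronglyMeasurable

theorem aestronglyMeasurable_holdingProb (h : ℝ) :
    AEStronglyMeasurable (holdingProb P.Ω P.ρ h) (volume.restrict P.Ω) :=
  aestronglyMeasurable_const.sub (P.aestronglyMeasurable_kernel h).integral_prod_right'

theorem abs_holdingProb_le (h : ℝ) {x : EuclideanSpace ℝ (Fin d)} (hx : x ∈ P.Ω) :
    |holdingProb P.Ω P.ρ h x| ≤ 1 + kernelBound d h * volume.real P.Ω := by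
  have h1 : ‖∫ y in P.Ω, metropolisKernel P.ρ h x y‖ ≤ kernelBound d h * volume.real P.Ω := by
    refine norm_setIntegral_le_of_norm_le_const P.isBounded.measure_lt_top fun y hy => ?_
    exact P.abs_kernel_le h hx hy
  rw [Real.norm_eq_abs] at h1
  unfold holdingProb
  calc _ ≤ |(1 : ℝ)| + |∫ y in P.Ω, metropolisKernel P.ρ h x y| := abs_sub _ _
    _ ≤ _ := by rw [abs_one]; gcongr

/-- Square integrable functions are integrable on `Ω`. -/
theorem integrableOn_Lp (u : Lp ℂ 2 P.μ) : IntegrableOn u P.Ω := by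
  have h1 : Integrable u P.μ := (Lp.memLp u).integrable one_le_two
  exact (h1.smul_measure P.inv_m_ne_top).mono_measure P.le_smul_μ

theorem integrableOn_kernel_mul (h : ℝ) (u : Lp ℂ 2 P.μ) :
    ∀ᵐ x ∂P.μ, IntegrableOn (fun y => (metropolisKernel P.ρ h x y : ℂ) * u y) P.Ω := by
  have hk : AEStronglyMeasurable
      (fun z : EuclideanSpace ℝ (Fin d) × EuclideanSpace ℝ (Fin d) =>
      (metropolisKernel P.ρ h z.1 z.2 : ℂ)) ((volume.restrict P.Ω).prod (volume.restrict P.Ω)) :=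
    Complex.continuous_ofReal.comp_aestronglyMeasurable (P.aestronglyMeasurable_kernel h)
  have h1 : ∀ᵐ x ∂(volume.restrict P.Ω), AEStronglyMeasurable
      (fun y => (metropolisKernel P.ρ h x y : ℂ)) (volume.restrict P.Ω) := hk.prodMk_left
  apply P.μ_ac.ae_le
  filter_upwards [h1, ae_restrict_mem P.isOpen.measurableSet] with x hx hxΩ
  refine (P.integrableOn_Lp u).bdd_mul (c := kernelBound d h) hx ?_
  filter_upwards [ae_restrict_mem P.isOpen.measurableSet] with y hy
  rw [Complex.norm_real]
  exact P.abs_kernel_le h hxΩ hy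

theorem ae_mem : ∀ᵐ x ∂P.μ, x ∈ P.Ω := P.μ_ac.ae_le (ae_restrict_mem P.isOpen.measurableSet)

theorem integral_norm_le (u : Lp ℂ 2 P.μ) : ∫ y in P.Ω, ‖u y‖ ≤ P.m⁻¹ * ‖u‖ := by
  have h1 : Integrable u P.μ := (Lp.memLp u).integrable one_le_two
  have h2 : ∫ y in P.Ω, ‖u y‖ ≤ ∫ y, ‖u y‖ ∂((ENNReal.ofReal P.m)⁻¹ • P.μ) :=
    integral_mono_measure P.le_smul_μ (ae_of_all _ fun _ => norm_nonneg _)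
      (h1.norm.smul_measure P.inv_m_ne_top)
  rw [integral_smul_measure, ENNReal.toReal_inv, ENNReal.toReal_ofReal P.m_pos.le,
    smul_eq_mul] at h2
  have h3 : ∫ y, ‖u y‖ ∂P.μ ≤ ‖u‖ := by
    rw [Lp.norm_def, integral_norm_eq_lintegral_enorm h1.1, ← eLpNorm_one_eq_lintegral_enorm]
    exact ENNReal.toReal_mono (Lp.eLpNorm_ne_top u)
      (eLpNorm_le_eLpNorm_of_exponent_le one_le_two h1.1)
  exact h2.trans (mul_le_mul_of_nonneg_left h3 (inv_nonneg.2 P.m_pos.le))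

theorem aestronglyMeasurable_action (h : ℝ) (u : Lp ℂ 2 P.μ) :
    AEStronglyMeasurable (metropolisAction P.Ω P.ρ h u) P.μ := by
  have hk : AEStronglyMeasurable
      (fun z : EuclideanSpace ℝ (Fin d) × EuclideanSpace ℝ (Fin d) =>
      (metropolisKernel P.ρ h z.1 z.2 : ℂ)) ((volume.restrict P.Ω).prod (volume.restrict P.Ω)) :=
    Complex.continuous_ofReal.comp_aestronglyMeasurable (P.aestronglyMeasurable_kernel h)
  have hu : AEStronglyMeasurable u (volume.restrict P.Ω) := (P.integrableOn_Lp u).1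
  have h1 : AEStronglyMeasurable
      (fun x => ∫ y in P.Ω, (metropolisKernel P.ρ h x y : ℂ) * u y) (volume.restrict P.Ω) :=
    (hk.mul hu.comp_snd).integral_prod_right'
  have h2 : AEStronglyMeasurable (fun x => (holdingProb P.Ω P.ρ h x : ℂ)) (volume.restrict P.Ω) :=
    Complex.continuous_ofReal.comp_aestronglyMeasurable (P.aestronglyMeasurable_holdingProb h)
  exact ((h2.mul hu).add h1).mono_ac P.μ_ac

theorem norm_action_le (h : ℝ) (u : Lp ℂ 2 P.μ) : ∀ᵐ x ∂P.μ, ‖metropolisAction P.Ω P.ρ h u x‖ ≤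
    (1 + kernelBound d h * volume.real P.Ω) * ‖u x‖ + kernelBound d h * (P.m⁻¹ * ‖u‖) := by
  filter_upwards [P.ae_mem] with x hx
  have h1 : ‖∫ y in P.Ω, (metropolisKernel P.ρ h x y : ℂ) * u y‖ ≤
      kernelBound d h * (P.m⁻¹ * ‖u‖) := by
    calc _ ≤ ∫ y in P.Ω, kernelBound d h * ‖u y‖ := by
          refine norm_integral_le_of_norm_le ((P.integrableOn_Lp u).norm.const_mul _) ?_
          filter_upwards [ae_restrict_mem P.isOpen.measurableSet] with y hy
          rw [norm_mul, Complex.norm_real]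
          exact mul_le_mul_of_nonneg_right (P.abs_kernel_le h hx hy) (norm_nonneg _)
      _ ≤ _ := by
          rw [integral_const_mul]
          exact mul_le_mul_of_nonneg_left (P.integral_norm_le u) (kernelBound_nonneg d h)
  unfold metropolisAction
  refine (norm_add_le _ _).trans (add_le_add ?_ h1)
  rw [norm_mul, Complex.norm_real]
  exact mul_le_mul_of_nonneg_right (P.abs_holdingProb_le h hx) (norm_nonneg _)

theorem memLp_action (h : ℝ) (u : Lp ℂ 2 P.μ) : MemLp (metropolisAction P.Ω P.ρ h u) 2 P.μ := by
  refine MemLp.of_le (((Lp.memLp u).norm.const_mul (1 + kernelBound d h * volume.real P.Ω)).add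
    (memLp_const (kernelBound d h * (P.m⁻¹ * ‖u‖)))) (P.aestronglyMeasurable_action h u) ?_
  filter_upwards [P.norm_action_le h u] with x hx
  exact hx.trans (le_abs_self _)

/-- The Metropolis operator `T_{h,ρ}` on `L²(Ω, ρ dx; ℂ)`, as a linear map. -/
def Tlin (h : ℝ) : Lp ℂ 2 P.μ →ₗ[ℂ] Lp ℂ 2 P.μ where
  toFun u := (P.memLp_action h u).toLp _
  map_add' u v := by
    rw [← MemLp.toLp_add, MemLp.toLp_eq_toLp_iff]
    filter_upwards [Lp.coeFn_add u v, P.integrableOn_kernel_mul h u,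
      P.integrableOn_kernel_mul h v] with x hx hu hv
    have h1 : ∫ y in P.Ω, (metropolisKernel P.ρ h x y : ℂ) * (u + v : Lp ℂ 2 P.μ) y =
        ∫ y in P.Ω, ((metropolisKernel P.ρ h x y : ℂ) * u y +
          (metropolisKernel P.ρ h x y : ℂ) * v y) := by
      refine integral_congr_ae ?_
      filter_upwards [P.ac_μ.ae_le (Lp.coeFn_add u v)] with y hy
      rw [hy, Pi.add_apply, mul_add]
    simp only [Pi.add_apply, metropolisAction]
    rw [h1, integral_add hu hv, hx, Pi.add_apply]
    ring
  map_smul' c u := by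
    rw [RingHom.id_apply, ← MemLp.toLp_const_smul, MemLp.toLp_eq_toLp_iff]
    filter_upwards [Lp.coeFn_smul c u] with x hx
    have h1 : ∫ y in P.Ω, (metropolisKernel P.ρ h x y : ℂ) * (c • u : Lp ℂ 2 P.μ) y =
        ∫ y in P.Ω, c * ((metropolisKernel P.ρ h x y : ℂ) * u y) := by
      refine integral_congr_ae ?_
      filter_upwards [P.ac_μ.ae_le (Lp.coeFn_smul c u)] with y hy
      rw [hy, Pi.smul_apply, smul_eq_mul]
      ring
    simp only [Pi.smul_apply, metropolisAction, smul_eq_mul]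
    rw [h1, integral_const_mul, hx, Pi.smul_apply, smul_eq_mul]
    ring

/-- The Metropolis operator `T_{h,ρ}` as a bounded operator on `L²(Ω, ρ dx; ℂ)`. -/
def T (h : ℝ) : Lp ℂ 2 P.μ →L[ℂ] Lp ℂ 2 P.μ :=
  (P.Tlin h).mkContinuous
    ((1 + kernelBound d h * volume.real P.Ω) + kernelBound d h * P.m⁻¹) (by
      intro u
      have hb := kernelBound_nonneg d h
      have hm := inv_nonneg.2 P.m_pos.le
      set F : Lp ℝ 2 P.μ :=
        ((Lp.memLp u).norm.const_mul (1 + kernelBound d h * volume.real P.Ω)).toLp _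
      set G : Lp ℝ 2 P.μ := (memLp_const (kernelBound d h * (P.m⁻¹ * ‖u‖))).toLp _
      have h1 : ‖P.Tlin h u‖ ≤ ‖F + G‖ := by
        refine Lp.norm_le_norm_of_ae_le ?_
        filter_upwards [P.norm_action_le h u, (P.memLp_action h u).coeFn_toLp,
          Lp.coeFn_add F G, MemLp.coeFn_toLp ((Lp.memLp u).norm.const_mul
            (1 + kernelBound d h * volume.real P.Ω)),
          MemLp.coeFn_toLp (μ := P.μ) (p := 2)
            (memLp_const (kernelBound d h * (P.m⁻¹ * ‖u‖)))] with x h1 h2 h3 h4 h5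
        have h6 : (P.Tlin h u) x = metropolisAction P.Ω P.ρ h u x := h2
        rw [h6, h3, Pi.add_apply, h4, h5]
        exact h1.trans (le_abs_self _)
      have h2 : ‖F‖ ≤ (1 + kernelBound d h * volume.real P.Ω) * ‖u‖ := by
        refine Lp.norm_le_mul_norm_of_ae_le_mul ?_
        filter_upwards [MemLp.coeFn_toLp ((Lp.memLp u).norm.const_mul
            (1 + kernelBound d h * volume.real P.Ω))] with x hx
        rw [hx, Real.norm_eq_abs, abs_mul, abs_norm, abs_of_nonneg (by positivity)]
      have h3 : ‖G‖ ≤ kernelBound d h * (P.m⁻¹ * ‖u‖) := by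
        have hG : ‖G‖ ≤ ‖kernelBound d h * (P.m⁻¹ * ‖u‖)‖ * P.μ.real univ ^ (1 / (2 : ℝ≥0∞).toReal) :=
          Lp.norm_const_le 2 P.μ _
        refine hG.trans ?_
        rw [Real.norm_eq_abs, abs_of_nonneg (by positivity)]
        simp
      calc _ ≤ ‖F‖ + ‖G‖ := h1.trans (norm_add_le _ _)
        _ ≤ _ := add_le_add h2 h3
        _ = _ := by ring)

/-- `T_{h,ρ}` is given by the Metropolis formula. -/
theorem T_apply_ae (h : ℝ) (u : Lp ℂ 2 P.μ) :
    P.T h u =ᵐ[P.μ] metropolisAction P.Ω P.ρ h u :=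
  (P.memLp_action h u).coeFn_toLp

end MetropolisSetting

/-- The essential spectrum of a bounded operator: the `z ∈ ℂ` such that `z - T` is not Fredholm.
For a self-adjoint operator this is the complement in the spectrum of the set of isolated
eigenvalues of finite multiplicity. -/
def essentialSpectrum {H : Type*} [NormedAddCommGroup H] [NormedSpace ℂ H] (T : H →L[ℂ] H) :
    Set ℂ :=
  {z | ¬ (z • ContinuousLinearMap.id ℂ H - T).IsFredholm}

/-! ### The boundary assumption -/

/-- Near each point of `∂Ω ∩ U`, the set `Ω` lies strictly above the graph, in some direction `n`,
of a Lipschitz function `f` on the hyperplane orthogonal to `n`. -/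
def HasLipschitzBoundaryIn {d : ℕ} (Ω U : Set (EuclideanSpace ℝ (Fin d))) : Prop :=
  ∀ p ∈ frontier Ω ∩ U, ∃ (n : EuclideanSpace ℝ (Fin d)) (K : ℝ≥0)
    (f : (Submodule.span ℝ {n})ᗮ → ℝ) (W : Set (EuclideanSpace ℝ (Fin d))),
    ‖n‖ = 1 ∧ LipschitzWith K f ∧ IsOpen W ∧ p ∈ W ∧
    ∀ x ∈ W, x ∈ Ω ↔ f ((Submodule.span ℝ {n})ᗮ.orthogonalProjectionOnto x) < inner ℝ n x

/-- `S` is a closed subset of `ℝᵈ` and a smooth embedded `k`-dimensional submanifold. -/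
def IsClosedSubmanifold {d : ℕ} (S : Set (EuclideanSpace ℝ (Fin d))) (k : ℕ) : Prop :=
  IsClosed S ∧ ∀ p ∈ S, ∃ e : OpenPartialHomeomorph (EuclideanSpace ℝ (Fin d))
      (EuclideanSpace ℝ (Fin k) × EuclideanSpace ℝ (Fin (d - k))),
    p ∈ e.source ∧ ContDiffOn ℝ (⊤ : ℕ∞) e e.source ∧ ContDiffOn ℝ (⊤ : ℕ∞) e.symm e.target ∧
    ∀ x ∈ e.source, x ∈ S ↔ (e x).2 = 0

/-- The model cusp `{(x₁, x', x'') : 0 < x₁ < ε, |x'| < x₁ ^ α, |x''| < r}` in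
`ℝ × ℝ^{d'} × ℝ^{d''}`. -/
def modelCusp (d' d'' : ℕ) (α r ε : ℝ) :
    Set (ℝ × EuclideanSpace ℝ (Fin d') × EuclideanSpace ℝ (Fin d'')) :=
  {x | 0 < x.1 ∧ x.1 < ε ∧ ‖x.2.1‖ < x.1 ^ α ∧ ‖x.2.2‖ < r}

/-- `φ` is a smooth coordinate system `(x₁, x', x'')` in the neighbourhood `φ.source` of `p`,
centred at `p`, in which `Ω ∩ U` is the model cusp. -/
structure IsCuspChart {d d' d'' : ℕ} (Ω U : Set (EuclideanSpace ℝ (Fin d))) (α r ε : ℝ)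
    (p : EuclideanSpace ℝ (Fin d))
    (φ : OpenPartialHomeomorph (EuclideanSpace ℝ (Fin d))
      (ℝ × EuclideanSpace ℝ (Fin d') × EuclideanSpace ℝ (Fin d''))) : Prop where
  mem_source : p ∈ φ.source
  contDiffOn : ContDiffOn ℝ (⊤ : ℕ∞) φ φ.source
  contDiffOn_symm : ContDiffOn ℝ (⊤ : ℕ∞) φ.symm φ.target
  map_center : φ p = 0
  mem_iff : ∀ x ∈ φ.source, x ∈ Ω ∩ U ↔ φ x ∈ modelCusp d' d'' α r ε

/-- A finite open cover of `∂Ω` by sets `Ur i` in which `∂Ω` is Lipschitz, and sets `Uc i` in which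
`Ω` has cusps along a closed submanifold `S i` of dimension `d'' i`. -/
structure CuspidalBoundary {d : ℕ} (Ω : Set (EuclideanSpace ℝ (Fin d))) where
  /-- the number of regular sets -/
  nr : ℕ
  /-- the number of cuspidal sets -/
  nc : ℕ
  /-- the regular sets -/
  Ur : Fin nr → Set (EuclideanSpace ℝ (Fin d))
  /-- the cuspidal sets -/
  Uc : Fin nc → Set (EuclideanSpace ℝ (Fin d))
  isOpen_Ur : ∀ i, IsOpen (Ur i)
  isOpen_Uc : ∀ i, IsOpen (Uc i)
  cover : frontier Ω ⊆ (⋃ i, Ur i) ∪ ⋃ i, Uc i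
  lipschitz : ∀ i, HasLipschitzBoundaryIn Ω (Ur i)
  /-- the set along which the cusp is located -/
  S : Fin nc → Set (EuclideanSpace ℝ (Fin d))
  /-- the dimension of the variable `x'` -/
  d' : Fin nc → ℕ
  /-- the dimension of the variable `x''` -/
  d'' : Fin nc → ℕ
  /-- the exponents of the cusps -/
  α : Fin nc → ℝ
  /-- the sizes in the variable `x''` -/
  r : Fin nc → ℝ
  /-- the sizes in the variable `x₁` -/
  ε : Fin nc → ℝ
  dim_eq : ∀ i, 1 + d' i + d'' i = d
  submanifold : ∀ i, IsClosedSubmanifold (S i) (d'' i)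
  one_lt_α : ∀ i, 1 < α i
  r_pos : ∀ i, 0 < r i
  ε_pos : ∀ i, 0 < ε i
  /-- the coordinate systems, one around each point of `S i` -/
  chart : ∀ i, S i → OpenPartialHomeomorph (EuclideanSpace ℝ (Fin d))
    (ℝ × EuclideanSpace ℝ (Fin (d' i)) × EuclideanSpace ℝ (Fin (d'' i)))
  isCuspChart : ∀ i (p : S i), IsCuspChart Ω (Uc i) (α i) (r i) (ε i) p (chart i p)
  /-- these coordinate systems describe the whole of `∂Ω ∩ Uc i` -/
  chart_cover : ∀ i, frontier Ω ∩ Uc i ⊆ ⋃ p : S i, (chart i p).source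

/-- `γ = max_i (α_i - 1) d'_i`; this is `0` if there is no cusp. -/
def CuspidalBoundary.γ {d : ℕ} {Ω : Set (EuclideanSpace ℝ (Fin d))} (A : CuspidalBoundary Ω) : ℝ :=
  ⨆ i, (A.α i - 1) * (A.d' i : ℝ)

end

/-! Write K(x,y) = ρ(x) k_h(x,y). Inside Ω this equals h^{-d} φ((x-y)/h) min(ρ(x), ρ(y)), which is
symmetric, so the form of `T h` is real: ⟪T u, u⟫ = ‖u‖² - D(u) + X(u), with D(u) = ∬ K |u(x)|²
(`diagForm`) and X(u) = ∬ K u(x) conj(u(y)) (`crossForm`). Three estimates locate the spectra.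

Top: D - X = ½ ∬ K |u(x) - u(y)|² is nonnegative, so the form is at most ‖u‖².

Bottom: D ≤ ‖u‖², hence ‖u‖² + ⟪T u, u⟫ ≥ D + X = ½ ∬ K |u(x) + u(y)|². On a set all of whose pairs
interact, the integral of |u(x) + u(y)|² controls the mass of the set times ∫ |u|². Averaging this
over small balls gives a bound from below by the least relative volume of Ω in a ball of radius h/4
centred in Ω (`lintegral_close_pairs_ge`, `le_integral_norm_add_sq`).

Essential spectrum: X comes from a Hilbert-Schmidt kernel, so it is arbitrarily small on a subspace
of finite codimension, where only the multiplication part ‖u‖² - D remains. D is bounded below by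
the relative volume of Ω in B(x,h) (`le_diagForm`), so t - T is coercive there, and therefore
Fredholm, as soon as t exceeds 1 minus that bound (`isFredholm_of_volume_ge`).

The problem is thus reduced to the geometric bound vol(Ω ∩ B(x,r)) ≥ c r^{d+γ}, uniform in x ∈ Ω and
small r (`CuspidalBoundary.hasVolumeLowerBound`). Division by h^d then leaves h^γ. The bound is
local by compactness of the closure of Ω. Interior points and Lipschitz boundary points give the
exponent d. A cusp gives 1 + α d' + d'' = d + (α - 1) d', by an explicit box in the model cusp
transported through the chart. -/

/-! ### Spectrum and Fredholm property from quadratic forms -/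

section Hilbert

open scoped InnerProductSpace

variable {H : Type*} [NormedAddCommGroup H] [InnerProductSpace ℂ H] [CompleteSpace H]

/-- If the quadratic form of a bounded operator is real with values in `[a, b]` on the unit sphere,
its spectrum is contained in `[a, b]`. -/
theorem spectrum_subset_image_Icc_of_form (T : H →L[ℂ] H) (a b : ℝ)
    (him : ∀ u, (⟪T u, u⟫_ℂ).im = 0) (ha : ∀ u, a * ‖u‖ ^ 2 ≤ (⟪T u, u⟫_ℂ).re)
    (hb : ∀ u, (⟪T u, u⟫_ℂ).re ≤ b * ‖u‖ ^ 2) :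
    spectrum ℂ T ⊆ (fun t : ℝ => (t : ℂ)) '' Icc a b := by
  intro z hz
  by_contra hcon
  apply hz
  have hre : ∀ u, (⟪(algebraMap ℂ (H →L[ℂ] H) z - T) u, u⟫_ℂ).re
      = z.re * ‖u‖ ^ 2 - (⟪T u, u⟫_ℂ).re := by
    intro u
    rw [sub_apply, inner_sub_left, Algebra.algebraMap_eq_smul_one,
      smul_apply, one_apply_eq_self, inner_smul_left,
      inner_self_eq_norm_sq_to_K]
    simp [← Complex.ofReal_pow]
  have himz : ∀ u, (⟪(algebraMap ℂ (H →L[ℂ] H) z - T) u, u⟫_ℂ).im = -z.im * ‖u‖ ^ 2 := by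
    intro u
    rw [sub_apply, inner_sub_left, Algebra.algebraMap_eq_smul_one,
      smul_apply, one_apply_eq_self, inner_smul_left,
      inner_self_eq_norm_sq_to_K]
    simp [← Complex.ofReal_pow, him u]
  -- A form bounded below in modulus by c‖u‖² belongs to an invertible operator. The three positions
  -- of z outside [a, b] give c = z.re - b, a - z.re or |z.im|.
  have key : ∀ c : ℝ, 0 < c → (∀ u, ‖u‖ ^ 2 * c ≤ ‖⟪(algebraMap ℂ (H →L[ℂ] H) z - T) u, u⟫_ℂ‖) →
      IsUnit (algebraMap ℂ (H →L[ℂ] H) z - T) := fun c hc h =>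
    ContinuousLinearMap.isUnit_of_forall_le_norm_inner_map _ (c := ⟨c, hc.le⟩) hc h
  by_cases h0 : z.im = 0
  · have hz' : ((z.re : ℝ) : ℂ) = z := by apply Complex.ext <;> simp [h0]
    by_cases h1 : a ≤ z.re
    · have h2 : b < z.re := by
        by_contra h2
        exact hcon ⟨z.re, ⟨h1, not_lt.1 h2⟩, hz'⟩
      refine key (z.re - b) (sub_pos.2 h2) fun u => ?_
      refine le_trans ?_ (Complex.re_le_norm _)
      rw [hre]
      nlinarith [hb u]
    · refine key (a - z.re) (sub_pos.2 (not_le.1 h1)) fun u => ?_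
      refine le_trans ?_ (Complex.abs_re_le_norm _)
      refine le_trans ?_ (neg_le_abs _)
      rw [hre]
      nlinarith [ha u]
  · refine key |z.im| (abs_pos.2 h0) fun u => ?_
    refine le_trans ?_ (Complex.abs_im_le_norm _)
    rw [himz, abs_mul, abs_neg, abs_of_nonneg (sq_nonneg ‖u‖), mul_comm]

open scoped LinearMap.FiniteRangeSetoid in
/-- An operator whose quadratic form is coercive on the orthogonal of a finite dimensional subspace
is Fredholm. -/
theorem isFredholm_of_coercive_on_orthogonal (A : H →L[ℂ] H) (S : Submodule ℂ H)
    [FiniteDimensional ℂ S] {c : ℝ} (hc : 0 < c)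
    (h : ∀ u ∈ Sᗮ, c * ‖u‖ ^ 2 ≤ (⟪A u, u⟫_ℂ).re) : A.IsFredholm := by
  set Q : H →L[ℂ] H := Sᗮ.starProjection with hQ
  set R : H →L[ℂ] H := S.starProjection with hR
  -- B replaces A by the identity on S and decouples S from its orthogonal. It differs from A by
  -- finite rank and is coercive on all of H with constant `min c 1`, so A is invertible modulo
  -- finite rank.
  set B : H →L[ℂ] H := Q ∘L A ∘L Q + R with hB
  have hsum : ∀ u, R u + Q u = u := fun u => S.starProjection_add_starProjection_orthogonal u
  have hRfin : (R : H →ₗ[ℂ] H).HasFiniteRange := by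
    have : (R : H →ₗ[ℂ] H).range = S := S.range_starProjection
    rw [LinearMap.HasFiniteRange, this]
    exact Module.Finite.iff_fg.1 inferInstance
  have hAB : (A : H →ₗ[ℂ] H) ≈ (B : H →ₗ[ℂ] H) := by
    rw [LinearMap.FiniteRangeSetoid.equiv_iff_hasFiniteRange]
    have : (A : H →ₗ[ℂ] H) - (B : H →ₗ[ℂ] H) =
        (R : H →ₗ[ℂ] H) ∘ₗ ((A : H →ₗ[ℂ] H) ∘ₗ (Q : H →ₗ[ℂ] H)) +
          (A : H →ₗ[ℂ] H) ∘ₗ (R : H →ₗ[ℂ] H) - (R : H →ₗ[ℂ] H) := by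
      ext u
      have h1 := hsum (A (Q u))
      have h2 : A u = A (R u) + A (Q u) := by rw [← map_add, hsum]
      simp only [LinearMap.sub_apply, LinearMap.add_apply, LinearMap.comp_apply,
        ContinuousLinearMap.coe_coe, hB, add_apply,
        ContinuousLinearMap.comp_apply]
      rw [h2, ← sub_eq_zero]
      nth_rw 1 [← h1]
      abel
    rw [this]
    exact ((hRfin.comp_right _).add (hRfin.comp_left _)).sub hRfin
  have hunit : IsUnit B := by
    refine ContinuousLinearMap.isUnit_of_forall_le_norm_inner_map B
      (c := ⟨min c 1, (lt_min hc one_pos).le⟩) (lt_min hc one_pos) fun u => ?_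
    refine le_trans ?_ (Complex.re_le_norm _)
    have h1 : ⟪B u, u⟫_ℂ = ⟪A (Q u), Q u⟫_ℂ + ⟪R u, R u⟫_ℂ := by
      rw [hB, add_apply, inner_add_left]
      congr 1
      · exact Submodule.inner_starProjection_left_eq_right _ _ _
      · rw [← Submodule.inner_starProjection_left_eq_right,
          Submodule.starProjection_eq_self_iff.2 (Submodule.starProjection_apply_mem _ _)]
    have h2 : ‖u‖ ^ 2 = ‖R u‖ ^ 2 + ‖Q u‖ ^ 2 := S.norm_sq_eq_add_norm_sq_starProjection u
    have h3 := h (Q u) (Submodule.starProjection_apply_mem _ _)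
    rw [h1, Complex.add_re, inner_self_eq_norm_sq_to_K, h2]
    have h4 : (((‖R u‖ : ℂ)) ^ 2).re = ‖R u‖ ^ 2 := by simp [← Complex.ofReal_pow]
    change _ ≤ _ + (((‖R u‖ : ℂ)) ^ 2).re
    rw [h4]
    change _ * min c 1 ≤ _
    nlinarith [min_le_left c 1, min_le_right c 1, sq_nonneg ‖R u‖, sq_nonneg ‖Q u‖]
  obtain ⟨w, hw⟩ := hunit
  let e : H ≃L[ℂ] H := ContinuousLinearEquiv.unitsEquiv ℂ H w
  have he : (e : H →L[ℂ] H) = B := by rw [← hw]; rfl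
  have h1 := e.toLinearEquiv.isQuasiInverse
  have h2 : (e.toLinearEquiv : H →ₗ[ℂ] H) = (B : H →ₗ[ℂ] H) := by
    rw [← he]; rfl
  rw [h2] at h1
  refine ContinuousLinearMap.IsFredholm.of_isQuasiInverse (v := (e.symm : H →L[ℂ] H)) ?_
  exact h1.congr (Setoid.refl _) hAB

end Hilbert

/-! ### Forms of bounded trace are small in finite codimension -/

section Orthonormal

variable {H : Type*} [NormedAddCommGroup H] [InnerProductSpace ℂ H]

/-- A homogeneous form whose sums along orthonormal families are bounded is small on the
orthogonal of some finite dimensional subspace. -/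
theorem exists_finiteDimensional_forall_orthogonal_le (q : H → ℝ)
    (hq : ∀ (c : ℂ) u, q (c • u) = ‖c‖ ^ 2 * q u) (C : ℝ)
    (hC : ∀ (n : ℕ) (e : Fin n → H), Orthonormal ℂ e → ∑ i, q (e i) ≤ C) {ε : ℝ} (hε : 0 < ε) :
    ∃ S : Submodule ℂ H, FiniteDimensional ℂ S ∧ ∀ u ∈ Sᗮ, q u ≤ ε * ‖u‖ ^ 2 := by
  by_contra hcon
  push Not at hcon
  -- If the conclusion fails, the orthogonal of the span of the vectors already chosen always
  -- contains a further unit vector with q ≥ ε. The families obtained are arbitrarily long, and nε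
  -- eventually exceeds C.
  have hseq : ∀ n : ℕ, ∃ e : Fin n → H, Orthonormal ℂ e ∧ ∀ i, ε ≤ q (e i) := by
    intro n
    induction n with
    | zero => exact ⟨Fin.elim0, ⟨fun i => i.elim0, fun i => i.elim0⟩, fun i => i.elim0⟩
    | succ n ih =>
      obtain ⟨e, he, heq⟩ := ih
      obtain ⟨u, hu, hqu⟩ := hcon (Submodule.span ℂ (range e))
        (FiniteDimensional.span_of_finite ℂ (finite_range e))
      have hu0 : u ≠ 0 := by
        rintro rfl
        have := hq 0 0
        simp at this
        simp [this] at hqu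
      have hn : 0 < ‖u‖ := norm_pos_iff.2 hu0
      have hc : ‖((‖u‖⁻¹ : ℝ) : ℂ)‖ = ‖u‖⁻¹ := by
        rw [Complex.norm_real, norm_inv, norm_norm]
      refine ⟨Matrix.vecCons (((‖u‖⁻¹ : ℝ) : ℂ) • u) e, ?_, ?_⟩
      · rw [orthonormal_vecCons_iff]
        refine ⟨?_, fun i => ?_, he⟩
        · rw [norm_smul, hc, inv_mul_cancel₀ hn.ne']
        · rw [inner_smul_left, Submodule.inner_left_of_mem_orthogonal
            (Submodule.subset_span (mem_range_self i)) hu, mul_zero]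
      · intro i
        refine Fin.cases ?_ (fun j => ?_) i
        · rw [Matrix.cons_val_zero, hq, hc, inv_pow, le_inv_mul_iff₀ (by positivity), mul_comm]
          exact hqu.le
        · rw [Matrix.cons_val_succ]; exact heq j
  obtain ⟨n, hn⟩ := exists_nat_gt (C / ε)
  obtain ⟨e, he, heq⟩ := hseq n
  have h1 := hC n e he
  have h2 : ∑ _i : Fin n, ε ≤ ∑ i, q (e i) := Finset.sum_le_sum fun i _ => heq i
  rw [Finset.sum_const, Finset.card_univ, Fintype.card_fin, nsmul_eq_mul] at h2
  rw [div_lt_iff₀ hε] at hn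
  linarith

end Orthonormal

noncomputable section

/-! ### The quadratic form of the Metropolis operator -/

namespace MetropolisSetting

open scoped InnerProductSpace ComplexConjugate

variable {d : ℕ} (P : MetropolisSetting d)

/-- The symmetric kernel `ρ(x) k_h(x,y)`. -/
def symKernel (h : ℝ) (x y : EuclideanSpace ℝ (Fin d)) : ℝ := P.ρ x * metropolisKernel P.ρ h x y

theorem ρ_pos {x : EuclideanSpace ℝ (Fin d)} (hx : x ∈ P.Ω) : 0 < P.ρ x :=
  P.m_pos.trans_le (P.m_le x hx)

theorem symKernel_eq (h : ℝ) {x : EuclideanSpace ℝ (Fin d)} (hx : x ∈ P.Ω)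
    (y : EuclideanSpace ℝ (Fin d)) :
    P.symKernel h x y = (h ^ d)⁻¹ * ballProfile (h⁻¹ • (x - y)) * min (P.ρ y) (P.ρ x) := by
  have h0 := P.ρ_pos hx
  have h1 : min (P.ρ y) (P.ρ x) = P.ρ x * min (P.ρ y / P.ρ x) 1 := by
    rw [mul_min_of_nonneg _ _ h0.le, mul_div_cancel₀ _ h0.ne', mul_one]
  rw [symKernel, metropolisKernel, h1]
  ring

theorem _root_.ballProfile_neg {d : ℕ} (z : EuclideanSpace ℝ (Fin d)) :
    ballProfile (-z) = ballProfile z := by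
  simp [ballProfile, indicator]

theorem _root_.ballProfile_nonneg {d : ℕ} (z : EuclideanSpace ℝ (Fin d)) : 0 ≤ ballProfile z :=
  indicator_nonneg (fun _ _ => by positivity) z

theorem symKernel_symm (h : ℝ) {x y : EuclideanSpace ℝ (Fin d)} (hx : x ∈ P.Ω) (hy : y ∈ P.Ω) :
    P.symKernel h x y = P.symKernel h y x := by
  rw [P.symKernel_eq h hx, P.symKernel_eq h hy, min_comm, ← ballProfile_neg, ← smul_neg, neg_sub]

theorem symKernel_nonneg {h : ℝ} (hh : 0 < h) {x y : EuclideanSpace ℝ (Fin d)} (hx : x ∈ P.Ω)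
    (hy : y ∈ P.Ω) : 0 ≤ P.symKernel h x y := by
  rw [P.symKernel_eq h hx]
  exact mul_nonneg (mul_nonneg (by positivity) (ballProfile_nonneg _))
    (le_min (P.ρ_pos hy).le (P.ρ_pos hx).le)

theorem abs_symKernel_le (h : ℝ) {x y : EuclideanSpace ℝ (Fin d)} (hx : x ∈ P.Ω) (hy : y ∈ P.Ω) :
    |P.symKernel h x y| ≤ P.M * kernelBound d h := by
  rw [symKernel, abs_mul, abs_of_pos (P.ρ_pos hx)]
  exact mul_le_mul (P.le_M x hx) (P.abs_kernel_le h hx hy) (abs_nonneg _)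
    ((P.ρ_pos hx).le.trans (P.le_M x hx))

theorem aestronglyMeasurable_symKernel (h : ℝ) :
    AEStronglyMeasurable (fun z : EuclideanSpace ℝ (Fin d) × EuclideanSpace ℝ (Fin d) =>
      P.symKernel h z.1 z.2) ((volume.restrict P.Ω).prod (volume.restrict P.Ω)) :=
  (P.aemeasurable.aestronglyMeasurable.comp_fst).mul (P.aestronglyMeasurable_kernel h)

theorem ae_prod_mem : ∀ᵐ z ∂(volume.restrict P.Ω).prod (volume.restrict P.Ω),
    z.1 ∈ P.Ω ∧ z.2 ∈ P.Ω := by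
  rw [Measure.prod_restrict]
  exact ae_restrict_mem (P.isOpen.measurableSet.prod P.isOpen.measurableSet)

theorem integrable_symKernel_mul (h : ℝ)
    {f : EuclideanSpace ℝ (Fin d) × EuclideanSpace ℝ (Fin d) → ℂ}
    (hf : Integrable f ((volume.restrict P.Ω).prod (volume.restrict P.Ω))) :
    Integrable (fun z => (P.symKernel h z.1 z.2 : ℂ) * f z)
      ((volume.restrict P.Ω).prod (volume.restrict P.Ω)) := by
  refine hf.bdd_mul (c := P.M * kernelBound d h)
    (Complex.continuous_ofReal.comp_aestronglyMeasurable (P.aestronglyMeasurable_symKernel h)) ?_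
  filter_upwards [P.ae_prod_mem] with z hz
  rw [Complex.norm_real]
  exact P.abs_symKernel_le h hz.1 hz.2

theorem memLp_restrict (u : Lp ℂ 2 P.μ) : MemLp u 2 (volume.restrict P.Ω) :=
  (Lp.memLp u).of_measure_le_smul P.inv_m_ne_top P.le_smul_μ

theorem integrable_norm_sq (u : Lp ℂ 2 P.μ) :
    Integrable (fun x => ‖u x‖ ^ 2) (volume.restrict P.Ω) :=
  (memLp_two_iff_integrable_sq_norm (P.memLp_restrict u).1).1 (P.memLp_restrict u)

/-- Integration against `μ_ρ`. -/
theorem integral_μ (f : EuclideanSpace ℝ (Fin d) → ℂ) :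
    ∫ x, f x ∂P.μ = ∫ x in P.Ω, (P.ρ x : ℂ) * f x := by
  rw [μ, integral_withDensity_eq_integral_toReal_smul₀ P.aemeasurable.ennreal_ofReal
    (ae_of_all _ fun _ => ENNReal.ofReal_lt_top)]
  refine integral_congr_ae ?_
  filter_upwards [ae_restrict_mem P.isOpen.measurableSet] with x hx
  rw [ENNReal.toReal_ofReal (P.ρ_pos hx).le, Complex.real_smul]

/-- The diagonal part `∬ K |u(x)|²`. -/
def diagForm (h : ℝ) (u : Lp ℂ 2 P.μ) : ℝ :=
  ∫ z, P.symKernel h z.1 z.2 * ‖u z.1‖ ^ 2 ∂(volume.restrict P.Ω).prod (volume.restrict P.Ω)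

/-- The off-diagonal part `∬ K u(x) conj(u(y))`. -/
def crossForm (h : ℝ) (u : Lp ℂ 2 P.μ) : ℂ :=
  ∫ z, (P.symKernel h z.1 z.2 : ℂ) * (u z.1 * conj (u z.2))
    ∂(volume.restrict P.Ω).prod (volume.restrict P.Ω)

theorem integrable_diag (h : ℝ) (u : Lp ℂ 2 P.μ) :
    Integrable (fun z : EuclideanSpace ℝ (Fin d) × EuclideanSpace ℝ (Fin d) =>
      (P.symKernel h z.1 z.2 : ℂ) * ((‖u z.1‖ : ℂ) ^ 2))
      ((volume.restrict P.Ω).prod (volume.restrict P.Ω)) := by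
  apply P.integrable_symKernel_mul
  have := ((P.integrable_norm_sq u).ofReal (𝕜 := ℂ)).mul_prod
    (integrable_const (μ := volume.restrict P.Ω) (1 : ℂ))
  simpa using this

theorem integrable_cross (h : ℝ) (u : Lp ℂ 2 P.μ) :
    Integrable (fun z : EuclideanSpace ℝ (Fin d) × EuclideanSpace ℝ (Fin d) =>
      (P.symKernel h z.1 z.2 : ℂ) * (u z.1 * conj (u z.2)))
      ((volume.restrict P.Ω).prod (volume.restrict P.Ω)) := by
  apply P.integrable_symKernel_mul
  have h1 : Integrable u (volume.restrict P.Ω) := P.integrableOn_Lp u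
  have h2 : Integrable (fun y => conj (u y)) (volume.restrict P.Ω) :=
    (Complex.conjCLE : ℂ →L[ℝ] ℂ).integrable_comp h1
  exact h1.mul_prod h2

theorem norm_sq_eq (u : Lp ℂ 2 P.μ) : ‖u‖ ^ 2 = ∫ x in P.Ω, P.ρ x * ‖u x‖ ^ 2 := by
  have h1 : ((‖u‖ : ℂ)) ^ 2 = ⟪u, u⟫_ℂ := (inner_self_eq_norm_sq_to_K (𝕜 := ℂ) u).symm
  rw [L2.inner_def, P.integral_μ] at h1
  have h2 : ∀ x, (P.ρ x : ℂ) * ⟪u x, u x⟫_ℂ = ((P.ρ x * ‖u x‖ ^ 2 : ℝ) : ℂ) := by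
    intro x
    rw [inner_self_eq_norm_sq_to_K]
    push_cast
    rfl
  simp_rw [h2] at h1
  rw [integral_complex_ofReal] at h1
  exact_mod_cast h1

theorem integrable_ρ_norm_sq (u : Lp ℂ 2 P.μ) :
    Integrable (fun x => P.ρ x * ‖u x‖ ^ 2) (volume.restrict P.Ω) := by
  refine (P.integrable_norm_sq u).bdd_mul (c := P.M) P.aemeasurable.aestronglyMeasurable ?_
  filter_upwards [ae_restrict_mem P.isOpen.measurableSet] with x hx
  rw [Real.norm_of_nonneg (P.ρ_pos hx).le]
  exact P.le_M x hx

theorem ofReal_diagForm (h : ℝ) (u : Lp ℂ 2 P.μ) : (P.diagForm h u : ℂ) =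
    ∫ x in P.Ω, ((∫ y in P.Ω, P.symKernel h x y : ℝ) : ℂ) * (‖u x‖ : ℂ) ^ 2 := by
  rw [diagForm, ← integral_complex_ofReal]
  have h1 := integral_prod _ (P.integrable_diag h u)
  push_cast
  rw [h1]
  congr 1
  ext x
  dsimp only
  rw [integral_mul_const, integral_complex_ofReal]

/-- The weight ρ turns the holding probability into ρ(x) - ∫ K(x,y) dy, whence ‖u‖² - D(u), and
turns the kernel into the symmetric K. -/
theorem inner_T_self (h : ℝ) (u : Lp ℂ 2 P.μ) :
    ⟪P.T h u, u⟫_ℂ = ((‖u‖ ^ 2 - P.diagForm h u : ℝ) : ℂ) + P.crossForm h u := by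
  rw [L2.inner_def]
  have h1 : ∫ x, ⟪P.T h u x, u x⟫_ℂ ∂P.μ =
      ∫ x, ⟪metropolisAction P.Ω P.ρ h u x, u x⟫_ℂ ∂P.μ := by
    refine integral_congr_ae ?_
    filter_upwards [P.T_apply_ae h u] with x hx
    rw [hx]
  rw [h1, P.integral_μ]
  have h2 : ∀ x, (P.ρ x : ℂ) * ⟪metropolisAction P.Ω P.ρ h u x, u x⟫_ℂ =
      ((P.ρ x * ‖u x‖ ^ 2 : ℝ) : ℂ) -
      ((∫ y in P.Ω, P.symKernel h x y : ℝ) : ℂ) * (‖u x‖ : ℂ) ^ 2 +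
      ∫ y in P.Ω, (P.symKernel h x y : ℂ) * (u x * conj (u y)) := by
    intro x
    have h3 : ∫ y in P.Ω, P.symKernel h x y = P.ρ x * ∫ y in P.Ω, metropolisKernel P.ρ h x y := by
      rw [← integral_const_mul]; rfl
    have h4 : conj (∫ y in P.Ω, (metropolisKernel P.ρ h x y : ℂ) * u y) =
        ∫ y in P.Ω, (metropolisKernel P.ρ h x y : ℂ) * conj (u y) := by
      rw [← integral_conj]
      simp
    have h5 : ∫ y in P.Ω, (P.symKernel h x y : ℂ) * (u x * conj (u y)) =
        (P.ρ x : ℂ) * u x * ∫ y in P.Ω, (metropolisKernel P.ρ h x y : ℂ) * conj (u y) := by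
      rw [← integral_const_mul]
      congr 1
      ext y
      rw [symKernel]
      push_cast
      ring
    have h6 : (‖u x‖ : ℂ) ^ 2 = u x * conj (u x) := by
      rw [Complex.mul_conj, Complex.normSq_eq_norm_sq]
      push_cast
      rfl
    rw [h3, h5, RCLike.inner_apply, metropolisAction, map_add, map_mul, Complex.conj_ofReal, h4,
      holdingProb]
    push_cast
    rw [h6]
    ring
  simp_rw [h2]
  have i1 := (P.integrable_ρ_norm_sq u).ofReal (𝕜 := ℂ)
  have i2 : Integrable (fun x => ((∫ y in P.Ω, P.symKernel h x y : ℝ) : ℂ) * (‖u x‖ : ℂ) ^ 2)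
      (volume.restrict P.Ω) := by
    refine (P.integrable_diag h u).integral_prod_left.congr (ae_of_all _ fun x => ?_)
    simp only
    rw [integral_mul_const, integral_complex_ofReal]
  have i3 := (P.integrable_cross h u).integral_prod_left
  have e1 := integral_add (i1.sub i2) i3
  have e2 := integral_sub i1 i2
  simp only [Pi.sub_apply] at e1
  refine e1.trans ?_
  rw [crossForm, integral_prod _ (P.integrable_cross h u), Complex.ofReal_sub, P.ofReal_diagForm,
    P.norm_sq_eq, ← integral_complex_ofReal]
  congr 1

/-- Exchanging x and y conjugates the integrand, since K is symmetric and real; this is the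
self-adjointness of the operator at the level of forms. -/
theorem crossForm_im (h : ℝ) (u : Lp ℂ 2 P.μ) : (P.crossForm h u).im = 0 := by
  rw [← Complex.conj_eq_iff_im, crossForm, ← integral_conj]
  rw [← integral_prod_swap]
  refine integral_congr_ae ?_
  filter_upwards [P.ae_prod_mem] with z hz
  simp only [Prod.fst_swap, Prod.snd_swap, map_mul, Complex.conj_ofReal, Complex.conj_conj]
  rw [P.symKernel_symm h hz.2 hz.1, mul_comm (u z.1)]

theorem integrable_symKernel_mul_fst (h : ℝ) (u : Lp ℂ 2 P.μ) :
    Integrable (fun z : EuclideanSpace ℝ (Fin d) × EuclideanSpace ℝ (Fin d) =>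
      P.symKernel h z.1 z.2 * ‖u z.1‖ ^ 2)
      ((volume.restrict P.Ω).prod (volume.restrict P.Ω)) := by
  refine (P.integrable_diag h u).re.congr (ae_of_all _ fun z => ?_)
  simp [← Complex.ofReal_pow]

theorem integrable_symKernel_mul_snd (h : ℝ) (u : Lp ℂ 2 P.μ) :
    Integrable (fun z : EuclideanSpace ℝ (Fin d) × EuclideanSpace ℝ (Fin d) =>
      P.symKernel h z.1 z.2 * ‖u z.2‖ ^ 2)
      ((volume.restrict P.Ω).prod (volume.restrict P.Ω)) := by
  refine (P.integrable_symKernel_mul_fst h u).swap.congr ?_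
  filter_upwards [P.ae_prod_mem] with z hz
  simp only [Function.comp, Prod.fst_swap, Prod.snd_swap]
  rw [P.symKernel_symm h hz.2 hz.1]

theorem symKernel_mul_norm_add_sq (h : ℝ) (u : Lp ℂ 2 P.μ) {s : ℝ} (hs : s ^ 2 = 1)
    (z : EuclideanSpace ℝ (Fin d) × EuclideanSpace ℝ (Fin d)) :
    P.symKernel h z.1 z.2 * ‖u z.1 + s * u z.2‖ ^ 2 =
      (P.symKernel h z.1 z.2 * ‖u z.1‖ ^ 2 + P.symKernel h z.1 z.2 * ‖u z.2‖ ^ 2) +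
      2 * s * RCLike.re ((P.symKernel h z.1 z.2 : ℂ) * (u z.1 * conj (u z.2))) := by
  rw [Complex.sq_norm, Complex.normSq_add, ← Complex.sq_norm, ← Complex.sq_norm, norm_mul,
    mul_pow, Complex.norm_real, Real.norm_eq_abs, sq_abs, hs, map_mul, Complex.conj_ofReal]
  simp only [RCLike.re_to_complex, Complex.re_ofReal_mul]
  rw [mul_left_comm (u z.1), Complex.re_ofReal_mul]
  ring

theorem integrable_symKernel_mul_norm_add_sq (h : ℝ) (u : Lp ℂ 2 P.μ) {s : ℝ} (hs : s ^ 2 = 1) :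
    Integrable (fun z : EuclideanSpace ℝ (Fin d) × EuclideanSpace ℝ (Fin d) =>
      P.symKernel h z.1 z.2 * ‖u z.1 + s * u z.2‖ ^ 2)
      ((volume.restrict P.Ω).prod (volume.restrict P.Ω)) := by
  simp_rw [P.symKernel_mul_norm_add_sq h u hs]
  exact ((P.integrable_symKernel_mul_fst h u).add (P.integrable_symKernel_mul_snd h u)).add
    ((P.integrable_cross h u).re.const_mul _)

/-- Symmetrization of the form. -/
theorem integral_norm_add_sq (h : ℝ) (u : Lp ℂ 2 P.μ) {s : ℝ} (hs : s ^ 2 = 1) :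
    ∫ z, P.symKernel h z.1 z.2 * ‖u z.1 + s * u z.2‖ ^ 2
      ∂(volume.restrict P.Ω).prod (volume.restrict P.Ω) =
    2 * (P.diagForm h u + s * (P.crossForm h u).re) := by
  have i1 := P.integrable_symKernel_mul_fst h u
  have i2 := P.integrable_symKernel_mul_snd h u
  have e2 : ∫ z, P.symKernel h z.1 z.2 * ‖u z.2‖ ^ 2
      ∂(volume.restrict P.Ω).prod (volume.restrict P.Ω) = P.diagForm h u := by
    rw [diagForm, ← integral_prod_swap]
    refine integral_congr_ae ?_
    filter_upwards [P.ae_prod_mem] with z hz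
    simp only [Prod.fst_swap, Prod.snd_swap]
    rw [P.symKernel_symm h hz.2 hz.1]
  have i3 := (P.integrable_cross h u).re
  have e3 : ∫ z, RCLike.re ((P.symKernel h z.1 z.2 : ℂ) * (u z.1 * conj (u z.2)))
      ∂(volume.restrict P.Ω).prod (volume.restrict P.Ω) = (P.crossForm h u).re :=
    integral_re (P.integrable_cross h u)
  simp_rw [P.symKernel_mul_norm_add_sq h u hs]
  have e5 := integral_add (i1.add i2) (i3.const_mul (2 * s))
  simp only [Pi.add_apply] at e5
  rw [e5, integral_const_mul, e3]
  have e6 := integral_add i1 i2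
  rw [e6, e2, ← diagForm]
  ring

end MetropolisSetting

end

noncomputable section

/-! ### A lower bound for the energy of `u(x) + u(y)` over close pairs -/

section CloseEnergy

open scoped ComplexConjugate

/-- Expanding the square, the right side is 2 ν(X) ∫ |u|² + 2 |∫ u|², and the last term is dropped.
-/
theorem two_mul_measure_mul_lintegral_le_lintegral_prod {X : Type*} [MeasurableSpace X]
    (ν : Measure X) [IsFiniteMeasure ν] (u : X → ℂ) (hu : MemLp u 2 ν) :
    2 * ν univ * ∫⁻ x, ‖u x‖ₑ ^ 2 ∂ν ≤ ∫⁻ z, ‖u z.1 + u z.2‖ₑ ^ 2 ∂ν.prod ν := by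
  have hu1 : Integrable u ν := hu.integrable one_le_two
  have hu2 : Integrable (fun x => ‖u x‖ ^ 2) ν := (memLp_two_iff_integrable_sq_norm hu.1).1 hu
  have hc : Integrable (fun y => conj (u y)) ν :=
    (Complex.conjCLE : ℂ →L[ℝ] ℂ).integrable_comp hu1
  have i1 : Integrable (fun z : X × X => ‖u z.1‖ ^ 2) (ν.prod ν) := by
    simpa using hu2.mul_prod (integrable_const (μ := ν) (1 : ℝ))
  have i2 : Integrable (fun z : X × X => ‖u z.2‖ ^ 2) (ν.prod ν) := i1.swap
  have i3 := hu1.mul_prod hc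
  have e1 : ∫ z : X × X, ‖u z.1‖ ^ 2 ∂ν.prod ν = ν.real univ * ∫ x, ‖u x‖ ^ 2 ∂ν := by
    have := integral_prod_mul (μ := ν) (ν := ν) (fun x => ‖u x‖ ^ 2) (fun _ => (1 : ℝ))
    simpa [mul_comm] using this
  have e2 : ∫ z : X × X, ‖u z.2‖ ^ 2 ∂ν.prod ν = ν.real univ * ∫ x, ‖u x‖ ^ 2 ∂ν := by
    rw [← e1]
    exact integral_prod_swap (μ := ν) (ν := ν) (fun z : X × X => ‖u z.1‖ ^ 2)
  have e3 : ∫ z : X × X, RCLike.re (u z.1 * conj (u z.2)) ∂ν.prod ν = ‖∫ x, u x ∂ν‖ ^ 2 := by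
    rw [integral_re i3, integral_prod_mul u (fun y => conj (u y)), integral_conj,
      Complex.mul_conj, Complex.normSq_eq_norm_sq]
    exact Complex.ofReal_re _
  have e4 : ∀ z : X × X, ‖u z.1 + u z.2‖ ^ 2 =
      (‖u z.1‖ ^ 2 + ‖u z.2‖ ^ 2) + 2 * RCLike.re (u z.1 * conj (u z.2)) := by
    intro z
    rw [Complex.sq_norm, Complex.normSq_add, ← Complex.sq_norm, ← Complex.sq_norm]
    rfl
  have i4 : Integrable (fun z : X × X => ‖u z.1 + u z.2‖ ^ 2) (ν.prod ν) := by
    simp_rw [e4]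
    exact (i1.add i2).add (i3.re.const_mul 2)
  have e5 : 2 * ν.real univ * ∫ x, ‖u x‖ ^ 2 ∂ν ≤ ∫ z, ‖u z.1 + u z.2‖ ^ 2 ∂ν.prod ν := by
    have e6 := integral_add (i1.add i2) (i3.re.const_mul 2)
    have e7 := integral_add i1 i2
    simp only [Pi.add_apply] at e6
    simp_rw [e4]
    rw [e6, e7, integral_const_mul, e3, e1, e2]
    nlinarith [sq_nonneg ‖∫ x, u x ∂ν‖]
  have e8 := ENNReal.ofReal_le_ofReal e5
  rw [ofReal_integral_eq_lintegral_ofReal i4 (ae_of_all _ fun _ => by positivity),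
    ENNReal.ofReal_mul (by positivity), ENNReal.ofReal_mul zero_le_two,
    ofReal_integral_eq_lintegral_ofReal hu2 (ae_of_all _ fun _ => by positivity),
    ofReal_measureReal] at e8
  simpa [ENNReal.ofReal_pow, ofReal_norm] using e8

/-- The inequality on a finite measure space is applied to Ω ∩ B(c, 2r) and integrated over all
centres c. A point x of Ω is seen by every c in B(x, r), and for these B(c, 2r) contains B(x, r),
hence mass at least v. Conversely, a pair is seen only if its distance is below 4r, and then by a
set of centres of volume at most that of a ball of radius 2r. -/
theorem lintegral_close_pairs_ge {d : ℕ} {Ω : Set (EuclideanSpace ℝ (Fin d))}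
    (hΩ : MeasurableSet Ω) [IsFiniteMeasure (volume.restrict Ω)] (u : EuclideanSpace ℝ (Fin d) → ℂ)
    (hum : Measurable u) (hu : MemLp u 2 (volume.restrict Ω)) {r : ℝ} (v : ℝ≥0∞)
    (hv : ∀ x ∈ Ω, v ≤ volume (Ω ∩ Metric.ball x r)) :
    2 * v * volume (Metric.ball (0 : EuclideanSpace ℝ (Fin d)) r) * ∫⁻ x in Ω, ‖u x‖ₑ ^ 2 ≤
      volume (Metric.ball (0 : EuclideanSpace ℝ (Fin d)) (2 * r)) *
        ∫⁻ z, (if dist z.1 z.2 < 4 * r then 1 else 0) * ‖u z.1 + u z.2‖ₑ ^ 2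
          ∂(volume.restrict Ω).prod (volume.restrict Ω) := by
  set ν := volume.restrict Ω with hν
  let E := EuclideanSpace ℝ (Fin d)
  let A : E → Set E := fun c => Metric.ball c (2 * r)
  have hA : ∀ c, MeasurableSet (A c) := fun c => Metric.isOpen_ball.measurableSet
  have hg : Measurable (fun z : E × E => ‖u z.1 + u z.2‖ₑ ^ 2) :=
    (((hum.comp measurable_fst).add (hum.comp measurable_snd)).enorm).pow_const 2
  have hpair : MeasurableSet {p : E × E | dist p.2 p.1 < 2 * r} :=
    measurableSet_lt (measurable_snd.dist measurable_fst) measurable_const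
  have hνA : Measurable fun c => ν (A c) := by
    have := measurable_measure_prodMk_left (ν := ν) hpair
    exact this
  have low : 2 * v * volume (Metric.ball (0 : E) r) * ∫⁻ x, ‖u x‖ₑ ^ 2 ∂ν ≤
      ∫⁻ c, ∫⁻ z, (A c ×ˢ A c).indicator (fun z : E × E => ‖u z.1 + u z.2‖ₑ ^ 2) z ∂ν.prod ν := by
    calc 2 * v * volume (Metric.ball (0 : E) r) * ∫⁻ x, ‖u x‖ₑ ^ 2 ∂ν
        = ∫⁻ x, 2 * v * volume (Metric.ball (0 : E) r) * ‖u x‖ₑ ^ 2 ∂ν := by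
          rw [lintegral_const_mul _ (hum.enorm.pow_const 2)]
      _ ≤ ∫⁻ x, ∫⁻ c, {p : E × E | dist p.2 p.1 < 2 * r}.indicator
            (fun p => 2 * ν (A p.1) * ‖u p.2‖ₑ ^ 2) (c, x) ∂volume ∂ν := by
          apply lintegral_mono_ae
          filter_upwards [ae_restrict_mem hΩ] with x hx
          calc 2 * v * volume (Metric.ball (0 : E) r) * ‖u x‖ₑ ^ 2
              = ∫⁻ c in Metric.ball x r, 2 * v * ‖u x‖ₑ ^ 2 := by
                rw [setLIntegral_const, Measure.addHaar_ball_center volume x r]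
                ring
            _ ≤ ∫⁻ c in Metric.ball x r, {p : E × E | dist p.2 p.1 < 2 * r}.indicator
                (fun p => 2 * ν (A p.1) * ‖u p.2‖ₑ ^ 2) (c, x) := by
                apply setLIntegral_mono_ae' Metric.isOpen_ball.measurableSet
                refine ae_of_all _ fun c hc => ?_
                have hr : 0 < r := dist_nonneg.trans_lt (Metric.mem_ball.1 hc)
                rw [indicator_of_mem]
                · gcongr
                  refine (hv x hx).trans ?_
                  rw [hν, Measure.restrict_apply (hA c), inter_comm]
                  refine measure_mono (inter_subset_inter_left _ fun y hy => ?_)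
                  rw [Metric.mem_ball] at hy hc ⊢
                  calc dist y c ≤ dist y x + dist x c := dist_triangle _ _ _
                    _ < 2 * r := by rw [dist_comm x c]; linarith
                · rw [Metric.mem_ball, dist_comm] at hc
                  change dist x c < 2 * r
                  linarith
            _ ≤ _ := setLIntegral_le_lintegral _ _
      _ = ∫⁻ c, ∫⁻ x, {p : E × E | dist p.2 p.1 < 2 * r}.indicator
            (fun p => 2 * ν (A p.1) * ‖u p.2‖ₑ ^ 2) (c, x) ∂ν ∂volume := by
          rw [lintegral_lintegral_swap]
          have : Measurable ({p : E × E | dist p.2 p.1 < 2 * r}.indicator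
            (fun p => 2 * ν (A p.1) * ‖u p.2‖ₑ ^ 2)) := by
            refine Measurable.indicator ?_ hpair
            exact ((hνA.comp measurable_fst).const_mul 2).mul
              ((hum.comp measurable_snd).enorm.pow_const 2)
          exact (this.comp measurable_swap).aemeasurable
      _ ≤ _ := by
          refine lintegral_mono fun c => ?_
          have h1 := two_mul_measure_mul_lintegral_le_lintegral_prod (ν.restrict (A c)) u
            (hu.restrict _)
          rw [Measure.prod_restrict, ← lintegral_indicator ((hA c).prod (hA c)),
            Measure.restrict_apply_univ, ← lintegral_indicator (hA c)] at h1
          refine le_trans (le_of_eq ?_) h1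
          rw [← lintegral_const_mul _ ((hum.enorm.pow_const 2).indicator (hA c))]
          refine lintegral_congr fun x => ?_
          by_cases hx : x ∈ A c
          · rw [indicator_of_mem (show (c, x) ∈ {p : E × E | dist p.2 p.1 < 2 * r} from hx),
              indicator_of_mem hx]
          · rw [indicator_of_notMem (show (c, x) ∉ {p : E × E | dist p.2 p.1 < 2 * r} from hx),
              indicator_of_notMem hx, mul_zero]
  -- Integrating over c first, a fixed pair z contributes only for centres in B(z.1, 2r).
  refine low.trans ?_
  rw [lintegral_lintegral_swap, ← lintegral_const_mul]
  · refine lintegral_mono fun z => ?_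
    have h1 : ∀ c, (A c ×ˢ A c).indicator (fun z : E × E => ‖u z.1 + u z.2‖ₑ ^ 2) z ≤
        (Metric.ball z.1 (2 * r)).indicator (fun _ =>
          (if dist z.1 z.2 < 4 * r then 1 else 0) * ‖u z.1 + u z.2‖ₑ ^ 2) c := by
      intro c
      by_cases hz : z ∈ A c ×ˢ A c
      · have hz1 : dist z.1 c < 2 * r := hz.1
        have hz2 : dist z.2 c < 2 * r := hz.2
        have : dist z.1 z.2 < 4 * r := by
          calc dist z.1 z.2 ≤ dist z.1 c + dist c z.2 := dist_triangle _ _ _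
            _ < 4 * r := by rw [dist_comm c]; linarith
        rw [indicator_of_mem hz, indicator_of_mem (by rw [Metric.mem_ball, dist_comm]; exact hz1),
          if_pos this, one_mul]
      · rw [indicator_of_notMem hz]; exact zero_le
    refine (lintegral_mono h1).trans ?_
    rw [lintegral_indicator Metric.isOpen_ball.measurableSet, setLIntegral_const,
      Measure.addHaar_ball_center, mul_comm]
  · refine Measurable.mul (Measurable.ite ?_ measurable_const measurable_const) hg
    exact measurableSet_lt (measurable_fst.dist measurable_snd) measurable_const
  · have hs : MeasurableSet {p : E × (E × E) | dist p.2.1 p.1 < 2 * r ∧ dist p.2.2 p.1 < 2 * r} :=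
      (measurableSet_lt ((measurable_fst.comp measurable_snd).dist measurable_fst)
        measurable_const).inter
      (measurableSet_lt ((measurable_snd.comp measurable_snd).dist measurable_fst)
        measurable_const)
    exact ((hg.comp measurable_snd).indicator hs).aemeasurable

end CloseEnergy

end

noncomputable section

/-! ### Bounds of the forms -/

theorem ballProfile_inv_smul_sub {d : ℕ} {h : ℝ} (hh : 0 < h) (x y : EuclideanSpace ℝ (Fin d)) :
    ballProfile (h⁻¹ • (x - y)) = (Metric.ball x h).indicator
      (fun _ => (volume.real (Metric.ball (0 : EuclideanSpace ℝ (Fin d)) 1))⁻¹) y := by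
  have h1 : h⁻¹ • (x - y) ∈ Metric.ball (0 : EuclideanSpace ℝ (Fin d)) 1 ↔ y ∈ Metric.ball x h := by
    rw [mem_ball_zero_iff, norm_smul, norm_inv, Real.norm_of_nonneg hh.le, inv_mul_lt_iff₀ hh,
      mul_one, Metric.mem_ball, dist_comm, dist_eq_norm]
  unfold ballProfile
  by_cases hy : y ∈ Metric.ball x h
  · rw [indicator_of_mem hy, indicator_of_mem (h1.2 hy)]
  · rw [indicator_of_notMem hy, indicator_of_notMem (fun h' => hy (h1.1 h'))]

theorem measureReal_ball_eq {d : ℕ} (x : EuclideanSpace ℝ (Fin d)) {h : ℝ} (hh : 0 < h) :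
    volume.real (Metric.ball x h) =
      h ^ d * volume.real (Metric.ball (0 : EuclideanSpace ℝ (Fin d)) 1) := by
  rw [measureReal_def, Measure.addHaar_ball_of_pos _ _ hh, ENNReal.toReal_mul,
    ENNReal.toReal_ofReal (by positivity), finrank_euclideanSpace_fin, measureReal_def]

theorem measureReal_unit_ball_pos (d : ℕ) :
    0 < volume.real (Metric.ball (0 : EuclideanSpace ℝ (Fin d)) 1) :=
  ENNReal.toReal_pos (Metric.measure_ball_pos _ _ one_pos).ne' measure_ball_lt_top.ne

namespace MetropolisSetting

open scoped InnerProductSpace ComplexConjugate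

variable {d : ℕ} (P : MetropolisSetting d)

theorem integral_ballProfile {h : ℝ} (hh : 0 < h) (x : EuclideanSpace ℝ (Fin d)) :
    ∫ y in P.Ω, (h ^ d)⁻¹ * ballProfile (h⁻¹ • (x - y)) = (h ^ d)⁻¹ *
      ((volume.real (Metric.ball (0 : EuclideanSpace ℝ (Fin d)) 1))⁻¹ *
        volume.real (P.Ω ∩ Metric.ball x h)) := by
  rw [integral_const_mul]
  simp_rw [ballProfile_inv_smul_sub hh]
  rw [integral_indicator Metric.isOpen_ball.measurableSet, setIntegral_const, smul_eq_mul,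
    measureReal_restrict_apply Metric.isOpen_ball.measurableSet, inter_comm]
  ring

theorem integrable_ballProfile {h : ℝ} (hh : 0 < h) (x : EuclideanSpace ℝ (Fin d)) :
    IntegrableOn (fun y => (h ^ d)⁻¹ * ballProfile (h⁻¹ • (x - y))) P.Ω := by
  simp_rw [ballProfile_inv_smul_sub hh]
  exact ((integrable_const _).indicator Metric.isOpen_ball.measurableSet).const_mul _

theorem integral_symKernel_le {h : ℝ} (hh : 0 < h) {x : EuclideanSpace ℝ (Fin d)} (hx : x ∈ P.Ω) :
    ∫ y in P.Ω, P.symKernel h x y ≤ P.ρ x := by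
  have hV := measureReal_unit_ball_pos d
  calc ∫ y in P.Ω, P.symKernel h x y
      ≤ ∫ y in P.Ω, (h ^ d)⁻¹ * ballProfile (h⁻¹ • (x - y)) * P.ρ x := by
        refine integral_mono_of_nonneg ?_ ((P.integrable_ballProfile hh x).mul_const _) ?_
        · filter_upwards [ae_restrict_mem P.isOpen.measurableSet] with y hy
          exact P.symKernel_nonneg hh hx hy
        · filter_upwards [ae_restrict_mem P.isOpen.measurableSet] with y hy
          rw [P.symKernel_eq h hx]
          exact mul_le_mul_of_nonneg_left (min_le_right _ _)
            (mul_nonneg (by positivity) (ballProfile_nonneg _))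
    _ ≤ 1 * P.ρ x := by
        rw [integral_mul_const]
        refine mul_le_mul_of_nonneg_right ?_ (P.ρ_pos hx).le
        rw [P.integral_ballProfile hh]
        have h1 : volume.real (P.Ω ∩ Metric.ball x h) ≤ _ :=
          (measureReal_mono inter_subset_right measure_ball_lt_top.ne).trans_eq
            (measureReal_ball_eq x hh)
        rw [inv_mul_le_iff₀ (by positivity), inv_mul_le_iff₀ hV, mul_one, mul_comm]
        exact h1
    _ = _ := one_mul _

theorem le_integral_symKernel {h : ℝ} (hh : 0 < h) {x : EuclideanSpace ℝ (Fin d)} (hx : x ∈ P.Ω)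
    (hint : Integrable (fun y => P.symKernel h x y) (volume.restrict P.Ω)) :
    (h ^ d)⁻¹ * ((volume.real (Metric.ball (0 : EuclideanSpace ℝ (Fin d)) 1))⁻¹ *
        volume.real (P.Ω ∩ Metric.ball x h)) * P.m ≤ ∫ y in P.Ω, P.symKernel h x y := by
  rw [← P.integral_ballProfile hh, ← integral_mul_const]
  refine integral_mono_ae ((P.integrable_ballProfile hh x).mul_const _) hint ?_
  filter_upwards [ae_restrict_mem P.isOpen.measurableSet] with y hy
  rw [P.symKernel_eq h hx]
  exact mul_le_mul_of_nonneg_left (le_min (P.m_le y hy) (P.m_le x hx))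
    (mul_nonneg (by positivity) (ballProfile_nonneg _))

theorem diagForm_eq (h : ℝ) (u : Lp ℂ 2 P.μ) : P.diagForm h u =
    ∫ x in P.Ω, (∫ y in P.Ω, P.symKernel h x y) * ‖u x‖ ^ 2 := by
  apply Complex.ofReal_injective
  rw [P.ofReal_diagForm, ← integral_complex_ofReal]
  push_cast
  rfl

theorem integrable_integral_symKernel_mul (h : ℝ) (u : Lp ℂ 2 P.μ) :
    Integrable (fun x => (∫ y in P.Ω, P.symKernel h x y) * ‖u x‖ ^ 2) (volume.restrict P.Ω) := by
  refine (P.integrable_symKernel_mul_fst h u).integral_prod_left.congr (ae_of_all _ fun x => ?_)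
  exact integral_mul_const (‖u x‖ ^ 2) (fun y => P.symKernel h x y)

theorem ae_integrable_symKernel (h : ℝ) :
    ∀ᵐ x ∂volume.restrict P.Ω, Integrable (fun y => P.symKernel h x y) (volume.restrict P.Ω) := by
  have h1 : Integrable (fun z : EuclideanSpace ℝ (Fin d) × EuclideanSpace ℝ (Fin d) =>
      P.symKernel h z.1 z.2) ((volume.restrict P.Ω).prod (volume.restrict P.Ω)) := by
    have := (P.integrable_symKernel_mul h (integrable_const (1 : ℂ))).re
    simpa using this
  exact h1.prod_right_ae

/-- Equivalent in content to the nonnegativity of the holding probability: a proposal has total mass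
at most 1. -/
theorem diagForm_le {h : ℝ} (hh : 0 < h) (u : Lp ℂ 2 P.μ) : P.diagForm h u ≤ ‖u‖ ^ 2 := by
  rw [P.diagForm_eq, P.norm_sq_eq]
  refine integral_mono_ae (P.integrable_integral_symKernel_mul h u) (P.integrable_ρ_norm_sq u) ?_
  filter_upwards [ae_restrict_mem P.isOpen.measurableSet] with x hx
  exact mul_le_mul_of_nonneg_right (P.integral_symKernel_le hh hx) (sq_nonneg _)

theorem M_pos : 0 < P.M := by
  obtain ⟨x, hx⟩ := P.isConnected.nonempty
  exact (P.ρ_pos hx).trans_le (P.le_M x hx)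

theorem norm_sq_le (u : Lp ℂ 2 P.μ) : ‖u‖ ^ 2 ≤ P.M * ∫ x in P.Ω, ‖u x‖ ^ 2 := by
  rw [P.norm_sq_eq, ← integral_const_mul]
  refine integral_mono_ae (P.integrable_ρ_norm_sq u) ((P.integrable_norm_sq u).const_mul _) ?_
  filter_upwards [ae_restrict_mem P.isOpen.measurableSet] with x hx
  exact mul_le_mul_of_nonneg_right (P.le_M x hx) (sq_nonneg _)

theorem m_mul_integral_le (u : Lp ℂ 2 P.μ) : P.m * ∫ x in P.Ω, ‖u x‖ ^ 2 ≤ ‖u‖ ^ 2 := by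
  rw [P.norm_sq_eq, ← integral_const_mul]
  refine integral_mono_ae ((P.integrable_norm_sq u).const_mul _) (P.integrable_ρ_norm_sq u) ?_
  filter_upwards [ae_restrict_mem P.isOpen.measurableSet] with x hx
  exact mul_le_mul_of_nonneg_right (P.m_le x hx) (sq_nonneg _)

/-- On B(x,h) ∩ Ω the symmetric kernel is at least m h^{-d} / vol B(0,1). The factor 1/M is the
price of returning from Lebesgue measure to ρ dx. -/
theorem le_diagForm {h v : ℝ} (hh : 0 < h) (hv0 : 0 ≤ v)
    (hv : ∀ x ∈ P.Ω, v ≤ volume.real (P.Ω ∩ Metric.ball x h)) (u : Lp ℂ 2 P.μ) :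
    (h ^ d)⁻¹ * (volume.real (Metric.ball (0 : EuclideanSpace ℝ (Fin d)) 1))⁻¹ * v * P.m / P.M *
      ‖u‖ ^ 2 ≤ P.diagForm h u := by
  have hV := measureReal_unit_ball_pos d
  have hm := P.m_pos
  have hM := P.M_pos
  set V := volume.real (Metric.ball (0 : EuclideanSpace ℝ (Fin d)) 1)
  calc (h ^ d)⁻¹ * V⁻¹ * v * P.m / P.M * ‖u‖ ^ 2
      ≤ (h ^ d)⁻¹ * V⁻¹ * v * P.m / P.M * (P.M * ∫ x in P.Ω, ‖u x‖ ^ 2) :=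
        mul_le_mul_of_nonneg_left (P.norm_sq_le u) (by positivity)
    _ = ∫ x in P.Ω, (h ^ d)⁻¹ * V⁻¹ * v * P.m * ‖u x‖ ^ 2 := by
        rw [integral_const_mul]; field_simp
    _ ≤ _ := by
        rw [P.diagForm_eq]
        refine integral_mono_ae ((P.integrable_norm_sq u).const_mul _)
          (P.integrable_integral_symKernel_mul h u) ?_
        filter_upwards [ae_restrict_mem P.isOpen.measurableSet, P.ae_integrable_symKernel h]
          with x hx hi
        refine mul_le_mul_of_nonneg_right (le_trans ?_ (P.le_integral_symKernel hh hx hi))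
          (sq_nonneg _)
        rw [mul_assoc _ V⁻¹ v]
        gcongr
        exact hv x hx

/-- By symmetrization the right side is ½ ∬ K |u(x) + u(y)|², and K ≥ κ on all pairs at distance
less than h. The close-pairs inequality applies with r = h/4, so that 4r = h. -/
theorem le_integral_norm_add_sq {h v : ℝ} (hh : 0 < h) (hv0 : 0 ≤ v)
    (hv : ∀ x ∈ P.Ω, v ≤ volume.real (P.Ω ∩ Metric.ball x (h / 4))) (u : Lp ℂ 2 P.μ) :
    (h ^ d)⁻¹ * (volume.real (Metric.ball (0 : EuclideanSpace ℝ (Fin d)) 1))⁻¹ * v * P.m / P.M *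
      (2 ^ d)⁻¹ * ‖u‖ ^ 2 ≤ P.diagForm h u + (P.crossForm h u).re := by
  have hV := measureReal_unit_ball_pos d
  have hm := P.m_pos
  have hM := P.M_pos
  set V := volume.real (Metric.ball (0 : EuclideanSpace ℝ (Fin d)) 1) with hVdef
  set ν := volume.restrict P.Ω with hν
  set I := ∫ x, ‖u x‖ ^ 2 ∂ν with hI
  have hI0 : 0 ≤ I := integral_nonneg fun _ => sq_nonneg _
  set κ := (h ^ d)⁻¹ * V⁻¹ * P.m with hκ
  have hκ0 : 0 ≤ κ := by positivity
  clear_value κ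
  have hsum := P.integral_norm_add_sq h u (s := 1) (by norm_num)
  have hint := P.integrable_symKernel_mul_norm_add_sq h u (s := 1) (by norm_num)
  simp only [Complex.ofReal_one, one_mul] at hsum hint
  set J := ∫ z, P.symKernel h z.1 z.2 * ‖u z.1 + u z.2‖ ^ 2 ∂ν.prod ν with hJ
  set L := ∫⁻ z, (if dist z.1 z.2 < 4 * (h / 4) then 1 else 0) * ‖u z.1 + u z.2‖ₑ ^ 2 ∂ν.prod ν
    with hL
  have hnonneg : 0 ≤ᵐ[ν.prod ν] fun z => P.symKernel h z.1 z.2 * ‖u z.1 + u z.2‖ ^ 2 := by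
    filter_upwards [P.ae_prod_mem] with z hz
    exact mul_nonneg (P.symKernel_nonneg hh hz.1 hz.2) (sq_nonneg _)
  have h1 : ENNReal.ofReal κ * L ≤ ENNReal.ofReal J := by
    rw [hJ, ofReal_integral_eq_lintegral_ofReal hint hnonneg, hL,
      ← lintegral_const_mul' _ _ ENNReal.ofReal_ne_top]
    refine lintegral_mono_ae ?_
    filter_upwards [P.ae_prod_mem] with z hz
    have h4 : 4 * (h / 4) = h := by ring
    rw [h4]
    split_ifs with hd
    · rw [one_mul, ← ofReal_norm, ← ENNReal.ofReal_pow (norm_nonneg _), ← ENNReal.ofReal_mul hκ0]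
      apply ENNReal.ofReal_le_ofReal
      refine mul_le_mul_of_nonneg_right ?_ (sq_nonneg _)
      rw [P.symKernel_eq h hz.1, ballProfile_inv_smul_sub hh, indicator_of_mem]
      · rw [hκ]
        exact mul_le_mul_of_nonneg_left (le_min (P.m_le _ hz.2) (P.m_le _ hz.1)) (by positivity)
      · rw [Metric.mem_ball, dist_comm]; exact hd
    · simp
  have h2 := lintegral_close_pairs_ge P.isOpen.measurableSet u (Lp.stronglyMeasurable u).measurable
    (P.memLp_restrict u) (r := h / 4) (ENNReal.ofReal v) (fun x hx => by
      rw [← ofReal_measureReal (measure_inter_lt_top_of_right_ne_top measure_ball_lt_top.ne).ne]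
      exact ENNReal.ofReal_le_ofReal (hv x hx))
  have hIe : ∫⁻ x, ‖u x‖ₑ ^ 2 ∂ν = ENNReal.ofReal I := by
    rw [hI, ofReal_integral_eq_lintegral_ofReal (P.integrable_norm_sq u)
      (ae_of_all _ fun _ => sq_nonneg _)]
    simp [ENNReal.ofReal_pow]
    rfl
  have hb : ∀ r : ℝ, 0 < r → volume (Metric.ball (0 : EuclideanSpace ℝ (Fin d)) r) =
      ENNReal.ofReal (r ^ d * V) := by
    intro r hr
    rw [← measureReal_ball_eq 0 hr, ofReal_measureReal]
  rw [← hν, ← hL, hIe, hb _ (by positivity), hb _ (by positivity)] at h2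
  have h3 : ENNReal.ofReal (κ * (2 * v * ((h / 4) ^ d * V) * I)) ≤
      ENNReal.ofReal ((2 * (h / 4)) ^ d * V * J) := by
    calc ENNReal.ofReal (κ * (2 * v * ((h / 4) ^ d * V) * I))
        = ENNReal.ofReal κ * (2 * ENNReal.ofReal v * ENNReal.ofReal ((h / 4) ^ d * V) *
            ENNReal.ofReal I) := by
          rw [ENNReal.ofReal_mul hκ0, ENNReal.ofReal_mul (by positivity),
            ENNReal.ofReal_mul (by positivity), ENNReal.ofReal_mul zero_le_two]
          simp
      _ ≤ ENNReal.ofReal κ * (ENNReal.ofReal ((2 * (h / 4)) ^ d * V) * L) := by gcongr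
      _ = ENNReal.ofReal ((2 * (h / 4)) ^ d * V) * (ENNReal.ofReal κ * L) := by ring
      _ ≤ ENNReal.ofReal ((2 * (h / 4)) ^ d * V) * ENNReal.ofReal J := by gcongr
      _ = _ := by rw [ENNReal.ofReal_mul (p := (2 * (h / 4)) ^ d * V) (by positivity)]
  have hJ0 : 0 ≤ J := integral_nonneg_of_ae hnonneg
  have h4 := (ENNReal.ofReal_le_ofReal_iff (by positivity)).1 h3
  -- The factor 2^d is the ratio of the volumes of the balls of radii h/2 and h/4.
  have h5 : κ * v * I ≤ 2 ^ d * (J / 2) := by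
    have hc : 0 < 2 * ((h / 4) ^ d * V) := by positivity
    refine le_of_mul_le_mul_left ?_ hc
    calc 2 * ((h / 4) ^ d * V) * (κ * v * I) = κ * (2 * v * ((h / 4) ^ d * V) * I) := by ring
      _ ≤ _ := h4
      _ = _ := by rw [mul_pow]; ring
  have h6 : P.diagForm h u + (P.crossForm h u).re = J / 2 := by rw [hsum]; ring
  rw [h6]
  calc (h ^ d)⁻¹ * V⁻¹ * v * P.m / P.M * (2 ^ d)⁻¹ * ‖u‖ ^ 2
      ≤ (h ^ d)⁻¹ * V⁻¹ * v * P.m / P.M * (2 ^ d)⁻¹ * (P.M * I) :=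
        mul_le_mul_of_nonneg_left (P.norm_sq_le u) (by positivity)
    _ = (2 ^ d)⁻¹ * (κ * v * I) := by rw [hκ]; field_simp
    _ ≤ (2 ^ d)⁻¹ * (2 ^ d * (J / 2)) := by gcongr
    _ = J / 2 := by field_simp

/-- The squared norm of the integral operator with kernel `symKernel`. -/
def imageForm (h : ℝ) (u : Lp ℂ 2 P.μ) : ℝ :=
  ∫ x in P.Ω, ‖∫ y in P.Ω, (P.symKernel h x y : ℂ) * conj (u y)‖ ^ 2

theorem imageForm_smul (h : ℝ) (c : ℂ) (u : Lp ℂ 2 P.μ) :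
    P.imageForm h (c • u) = ‖c‖ ^ 2 * P.imageForm h u := by
  rw [imageForm, imageForm, ← integral_const_mul]
  congr 1
  ext x
  have h1 : ∫ y in P.Ω, (P.symKernel h x y : ℂ) * conj ((c • u : Lp ℂ 2 P.μ) y) =
      conj c * ∫ y in P.Ω, (P.symKernel h x y : ℂ) * conj (u y) := by
    rw [← integral_const_mul]
    refine integral_congr_ae ?_
    filter_upwards [P.ac_μ.ae_le (Lp.coeFn_smul c u)] with y hy
    rw [hy, Pi.smul_apply, smul_eq_mul, map_mul]
    ring
  rw [h1, norm_mul, RCLike.norm_conj, mul_pow]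

/-- The sections of the kernel as elements of `L²`. -/
theorem ae_exists_integral_eq_inner (h : ℝ) : ∀ᵐ x ∂volume.restrict P.Ω,
    ∃ g : Lp ℂ 2 P.μ, ‖g‖ ≤ P.M * kernelBound d h * P.m⁻¹ ∧
      ∀ u : Lp ℂ 2 P.μ, ∫ y in P.Ω, (P.symKernel h x y : ℂ) * conj (u y) = ⟪u, g⟫_ℂ := by
  filter_upwards [(P.aestronglyMeasurable_symKernel h).prodMk_left,
    ae_restrict_mem P.isOpen.measurableSet] with x hx hxΩ
  -- Division by ρ(y) makes an integral against dy an inner product in L²(ρ dy).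
  have hm : AEStronglyMeasurable (fun y => ((P.symKernel h x y * (P.ρ y)⁻¹ : ℝ) : ℂ)) P.μ :=
    (Complex.continuous_ofReal.comp_aestronglyMeasurable
      (hx.mul P.aemeasurable.inv.aestronglyMeasurable)).mono_ac P.μ_ac
  have hb : ∀ᵐ y ∂P.μ, ‖((P.symKernel h x y * (P.ρ y)⁻¹ : ℝ) : ℂ)‖ ≤
      P.M * kernelBound d h * P.m⁻¹ := by
    filter_upwards [P.ae_mem] with y hy
    rw [Complex.norm_real, norm_mul, norm_inv, Real.norm_of_nonneg (P.ρ_pos hy).le]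
    exact mul_le_mul (P.abs_symKernel_le h hxΩ hy) (inv_anti₀ P.m_pos (P.m_le y hy))
      (inv_nonneg.2 (P.ρ_pos hy).le) (mul_nonneg P.M_pos.le (kernelBound_nonneg d h))
  have hL : MemLp (fun y => ((P.symKernel h x y * (P.ρ y)⁻¹ : ℝ) : ℂ)) 2 P.μ :=
    MemLp.of_bound hm _ hb
  refine ⟨hL.toLp _, ?_, fun u => ?_⟩
  · have h0 : 0 ≤ P.M * kernelBound d h * P.m⁻¹ :=
      mul_nonneg (mul_nonneg P.M_pos.le (kernelBound_nonneg d h)) (inv_nonneg.2 P.m_pos.le)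
    have := Lp.norm_le_of_ae_bound (f := hL.toLp _) h0 (by
      filter_upwards [hL.coeFn_toLp, hb] with y h1 h2
      rw [h1]; exact h2)
    simpa [measureUnivNNReal] using this
  · rw [L2.inner_def, P.integral_μ]
    refine integral_congr_ae ?_
    filter_upwards [P.ac_μ.ae_le hL.coeFn_toLp, ae_restrict_mem P.isOpen.measurableSet] with y hy hyΩ
    have h0 : (P.ρ y : ℂ) ≠ 0 := by exact_mod_cast (P.ρ_pos hyΩ).ne'
    rw [hy, RCLike.inner_apply]
    push_cast
    field_simp

theorem aestronglyMeasurable_integral_symKernel (h : ℝ) (u : Lp ℂ 2 P.μ) :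
    AEStronglyMeasurable (fun x => ∫ y in P.Ω, (P.symKernel h x y : ℂ) * conj (u y))
      (volume.restrict P.Ω) := by
  have hk : AEStronglyMeasurable
      (fun z : EuclideanSpace ℝ (Fin d) × EuclideanSpace ℝ (Fin d) =>
      (P.symKernel h z.1 z.2 : ℂ)) ((volume.restrict P.Ω).prod (volume.restrict P.Ω)) :=
    Complex.continuous_ofReal.comp_aestronglyMeasurable (P.aestronglyMeasurable_symKernel h)
  have hu : AEStronglyMeasurable (fun y => conj (u y)) (volume.restrict P.Ω) :=
    Complex.continuous_conj.comp_aestronglyMeasurable (P.integrableOn_Lp u).1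
  exact (hk.mul hu.comp_snd).integral_prod_right'

theorem integrable_norm_integral_sq (h : ℝ) (u : Lp ℂ 2 P.μ) :
    Integrable (fun x => ‖∫ y in P.Ω, (P.symKernel h x y : ℂ) * conj (u y)‖ ^ 2)
      (volume.restrict P.Ω) := by
  refine Integrable.of_bound ((P.aestronglyMeasurable_integral_symKernel h u).norm.pow 2)
    ((‖u‖ * (P.M * kernelBound d h * P.m⁻¹)) ^ 2) ?_
  filter_upwards [P.ae_exists_integral_eq_inner h] with x hx
  obtain ⟨g, hg, hgu⟩ := hx
  rw [hgu, norm_pow, norm_norm]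
  gcongr
  exact (norm_inner_le_norm _ _).trans (by gcongr)

/-- This is the Hilbert-Schmidt bound: for almost every x, Bessel's inequality bounds the sum by the
squared norm of the section of the kernel at x, and Ω has finite volume. -/
theorem sum_imageForm_le (h : ℝ) (n : ℕ) (e : Fin n → Lp ℂ 2 P.μ) (he : Orthonormal ℂ e) :
    ∑ i, P.imageForm h (e i) ≤
      (P.M * kernelBound d h * P.m⁻¹) ^ 2 * volume.real P.Ω := by
  simp only [imageForm]
  rw [← integral_finsetSum _ fun i _ => P.integrable_norm_integral_sq h (e i)]
  calc _ ≤ ∫ _x in P.Ω, (P.M * kernelBound d h * P.m⁻¹) ^ 2 := by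
        refine integral_mono_ae
          (integrable_finsetSum _ fun i _ => P.integrable_norm_integral_sq h (e i))
          (integrable_const _) ?_
        filter_upwards [P.ae_exists_integral_eq_inner h] with x hx
        obtain ⟨g, hg, hgu⟩ := hx
        simp_rw [hgu]
        refine (he.sum_inner_products_le (s := Finset.univ) g).trans ?_
        gcongr
    _ = _ := by rw [setIntegral_const, smul_eq_mul, mul_comm]

/-- Weighted arithmetic-geometric inequality ab ≤ (t/2) a² + b²/(2t) under the integral; t is chosen
later to balance the two terms. -/
theorem norm_crossForm_le (h : ℝ) (u : Lp ℂ 2 P.μ) {t : ℝ} (ht : 0 < t) :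
    ‖P.crossForm h u‖ ≤ t / 2 * (∫ x in P.Ω, ‖u x‖ ^ 2) + (2 * t)⁻¹ * P.imageForm h u := by
  rw [crossForm, integral_prod _ (P.integrable_cross h u), imageForm, ← integral_const_mul,
    ← integral_const_mul, ← integral_add ((P.integrable_norm_sq u).const_mul _)
      ((P.integrable_norm_integral_sq h u).const_mul _)]
  refine norm_integral_le_of_norm_le (((P.integrable_norm_sq u).const_mul _).add
      ((P.integrable_norm_integral_sq h u).const_mul _)) (ae_of_all _ fun x => ?_)
  have h1 : ∫ y in P.Ω, (P.symKernel h x y : ℂ) * (u x * conj (u y)) =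
      u x * ∫ y in P.Ω, (P.symKernel h x y : ℂ) * conj (u y) := by
    rw [← integral_const_mul]
    congr 1
    ext y
    ring
  dsimp only
  rw [h1, norm_mul]
  set a := ‖u x‖
  set b := ‖∫ y in P.Ω, (P.symKernel h x y : ℂ) * conj (u y)‖
  have h2 : t / 2 * a ^ 2 + (2 * t)⁻¹ * b ^ 2 - a * b = (t * a - b) ^ 2 / (2 * t) := by
    field_simp
    ring
  have h3 : 0 ≤ (t * a - b) ^ 2 / (2 * t) := by positivity
  linarith

/-- The integral part of the operator is small on a subspace of finite codimension. -/
theorem exists_finiteDimensional_norm_crossForm_le (h : ℝ) {η : ℝ} (hη : 0 < η) :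
    ∃ S : Submodule ℂ (Lp ℂ 2 P.μ), FiniteDimensional ℂ S ∧
      ∀ u ∈ Sᗮ, ‖P.crossForm h u‖ ≤ η * ‖u‖ ^ 2 := by
  have hm := P.m_pos
  -- With ε = η² m and t = η m, each of the two terms is at most (η/2)‖u‖².
  obtain ⟨S, hS, hS'⟩ := exists_finiteDimensional_forall_orthogonal_le (P.imageForm h)
    (P.imageForm_smul h) _ (P.sum_imageForm_le h) (ε := η ^ 2 * P.m) (by positivity)
  refine ⟨S, hS, fun u hu => (P.norm_crossForm_le h u (t := η * P.m) (by positivity)).trans ?_⟩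
  have h1 := P.m_mul_integral_le u
  have h2 := hS' u hu
  calc η * P.m / 2 * (∫ x in P.Ω, ‖u x‖ ^ 2) + (2 * (η * P.m))⁻¹ * P.imageForm h u
      ≤ η / 2 * ‖u‖ ^ 2 + (2 * (η * P.m))⁻¹ * (η ^ 2 * P.m * ‖u‖ ^ 2) := by
        gcongr ?_ + _ * ?_
        · nlinarith
    _ = _ := by field_simp; ring

end MetropolisSetting

end

noncomputable section

/-! ### Spectral localization from a lower bound of volumes -/

theorem isFredholm_of_isUnit {H : Type*} [NormedAddCommGroup H] [InnerProductSpace ℂ H]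
    [CompleteSpace H] {A : H →L[ℂ] H} (hA : IsUnit A) : A.IsFredholm := by
  obtain ⟨w, rfl⟩ := hA
  let e : H ≃L[ℂ] H := ContinuousLinearEquiv.unitsEquiv ℂ H w
  exact ContinuousLinearMap.IsFredholm.of_isQuasiInverse (v := (e.symm : H →L[ℂ] H))
    e.toLinearEquiv.isQuasiInverse

theorem essentialSpectrum_subset_spectrum {H : Type*} [NormedAddCommGroup H]
    [InnerProductSpace ℂ H] [CompleteSpace H] (T : H →L[ℂ] H) :
    essentialSpectrum T ⊆ spectrum ℂ T := by
  intro z hz hu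
  refine hz ?_
  have : z • ContinuousLinearMap.id ℂ H - T = algebraMap ℂ (H →L[ℂ] H) z - T := by
    rw [Algebra.algebraMap_eq_smul_one]; rfl
  rw [this]
  exact isFredholm_of_isUnit hu

namespace MetropolisSetting

open scoped InnerProductSpace ComplexConjugate

variable {d : ℕ} (P : MetropolisSetting d)

theorem inner_T_self_im (h : ℝ) (u : Lp ℂ 2 P.μ) : (⟪P.T h u, u⟫_ℂ).im = 0 := by
  rw [P.inner_T_self, Complex.add_im, Complex.ofReal_im, P.crossForm_im, zero_add]

theorem inner_T_self_re (h : ℝ) (u : Lp ℂ 2 P.μ) :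
    (⟪P.T h u, u⟫_ℂ).re = ‖u‖ ^ 2 - P.diagForm h u + (P.crossForm h u).re := by
  rw [P.inner_T_self, Complex.add_re, Complex.ofReal_re]

theorem inner_T_self_re_le {h : ℝ} (hh : 0 < h) (u : Lp ℂ 2 P.μ) :
    (⟪P.T h u, u⟫_ℂ).re ≤ ‖u‖ ^ 2 := by
  have h1 := P.integral_norm_add_sq h u (s := -1) (by norm_num)
  have h2 : 0 ≤ ∫ z, P.symKernel h z.1 z.2 * ‖u z.1 + ((-1 : ℝ) : ℂ) * u z.2‖ ^ 2
      ∂(volume.restrict P.Ω).prod (volume.restrict P.Ω) := by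
    refine integral_nonneg_of_ae ?_
    filter_upwards [P.ae_prod_mem] with z hz
    exact mul_nonneg (P.symKernel_nonneg hh hz.1 hz.2) (sq_nonneg _)
  rw [P.inner_T_self_re]
  linarith

/-- The form of T + 1 is 2(‖u‖² - D) + (D + X); the first term is nonnegative and the second is
bounded below by the volume. -/
theorem spectrum_subset_of_volume_ge {h v : ℝ} (hh : 0 < h) (hv0 : 0 ≤ v)
    (hv : ∀ x ∈ P.Ω, v ≤ volume.real (P.Ω ∩ Metric.ball x (h / 4))) :
    spectrum ℂ (P.T h) ⊆ (fun t : ℝ => (t : ℂ)) '' Icc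
      (-1 + (h ^ d)⁻¹ * (volume.real (Metric.ball (0 : EuclideanSpace ℝ (Fin d)) 1))⁻¹ * v * P.m /
        P.M * (2 ^ d)⁻¹) 1 := by
  refine spectrum_subset_image_Icc_of_form _ _ _ (P.inner_T_self_im h) (fun u => ?_) fun u => ?_
  · have h1 := P.le_integral_norm_add_sq hh hv0 hv u
    have h2 := P.diagForm_le hh u
    rw [P.inner_T_self_re, add_mul]
    linarith
  · rw [one_mul]; exact P.inner_T_self_re_le hh u

theorem isFredholm_of_volume_ge {h v t : ℝ} (hh : 0 < h) (hv0 : 0 ≤ v)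
    (hv : ∀ x ∈ P.Ω, v ≤ volume.real (P.Ω ∩ Metric.ball x h))
    (ht : 1 - (h ^ d)⁻¹ * (volume.real (Metric.ball (0 : EuclideanSpace ℝ (Fin d)) 1))⁻¹ * v *
      P.m / P.M < t) :
    ((t : ℂ) • ContinuousLinearMap.id ℂ (Lp ℂ 2 P.μ) - P.T h).IsFredholm := by
  set g := (h ^ d)⁻¹ * (volume.real (Metric.ball (0 : EuclideanSpace ℝ (Fin d)) 1))⁻¹ * v *
      P.m / P.M with hg
  -- The diagonal part of t - T is at least (t - 1 + g)‖u‖². Letting the cross form consume half of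
  -- it leaves coercivity with constant η.
  have hη : 0 < (t - 1 + g) / 2 := by linarith
  obtain ⟨S, hS, hSu⟩ := P.exists_finiteDimensional_norm_crossForm_le h hη
  refine isFredholm_of_coercive_on_orthogonal _ S hη fun u hu => ?_
  have h1 : (⟪((t : ℂ) • ContinuousLinearMap.id ℂ (Lp ℂ 2 P.μ) - P.T h) u, u⟫_ℂ).re =
      t * ‖u‖ ^ 2 - (⟪P.T h u, u⟫_ℂ).re := by
    rw [sub_apply, inner_sub_left, smul_apply, ContinuousLinearMap.id_apply, inner_smul_left,
      inner_self_eq_norm_sq_to_K]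
    simp [← Complex.ofReal_pow]
  rw [h1, P.inner_T_self_re]
  have h2 := P.le_diagForm hh hv0 hv u
  have h3 := (Complex.re_le_norm _).trans (hSu u hu)
  rw [← hg] at h2
  nlinarith

theorem spectra_subset_of_forall_volume_ge {γ c r₀ : ℝ} (hc : 0 < c) (hr₀ : 0 < r₀)
    (hvol : ∀ x ∈ P.Ω, ∀ r : ℝ, 0 < r → r ≤ r₀ →
      c * r ^ (d + γ) ≤ volume.real (P.Ω ∩ Metric.ball x r)) :
    ∃ δ₁ δ₂ h₀ : ℝ, 0 < δ₁ ∧ 0 < δ₂ ∧ 0 < h₀ ∧ ∀ h : ℝ, 0 < h → h ≤ h₀ →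
      spectrum ℂ (P.T h) ⊆
        (fun t : ℝ => (t : ℂ)) '' Set.Icc (-1 + δ₁ * h ^ γ) 1 ∧
      essentialSpectrum (P.T h) ⊆
        (fun t : ℝ => (t : ℂ)) '' Set.Icc (-1 + δ₁ * h ^ γ) (1 - δ₂ * h ^ γ) := by
  have hV := measureReal_unit_ball_pos d
  have hm := P.m_pos
  have hM := P.M_pos
  set V := volume.real (Metric.ball (0 : EuclideanSpace ℝ (Fin d)) 1) with hVdef
  -- δ₁ comes from balls of radius h/4 and loses (1/4)^{d+γ} and 2^{-d}; δ₂ comes from balls of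
  -- radius h.
  refine ⟨V⁻¹ * (c * (4⁻¹ : ℝ) ^ (d + γ)) * P.m / P.M * (2 ^ d)⁻¹, V⁻¹ * c * P.m / P.M, r₀,
    by positivity, by positivity, hr₀, fun h hh hh₀ => ?_⟩
  have hspl : h ^ (d + γ) = h ^ d * h ^ γ := by
    rw [Real.rpow_add hh, Real.rpow_natCast]
  have e1 : V⁻¹ * (c * (4⁻¹ : ℝ) ^ (d + γ)) * P.m / P.M * (2 ^ d)⁻¹ * h ^ γ =
      (h ^ d)⁻¹ * V⁻¹ * (c * (h / 4) ^ (d + γ)) * P.m / P.M * (2 ^ d)⁻¹ := by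
    rw [div_eq_mul_inv h 4, Real.mul_rpow hh.le (by norm_num), hspl]
    field_simp
  have e2 : V⁻¹ * c * P.m / P.M * h ^ γ =
      (h ^ d)⁻¹ * V⁻¹ * (c * h ^ (d + γ)) * P.m / P.M := by
    rw [hspl]
    field_simp
  have hspec := P.spectrum_subset_of_volume_ge hh (v := c * (h / 4) ^ (d + γ)) (by positivity)
    fun x hx => hvol x hx (h / 4) (by positivity) (by linarith)
  rw [e1, e2]
  refine ⟨hspec, fun z hz => ?_⟩
  -- The spectrum is already known to be real, so only real t has to be excluded above 1 - δ₂ h^γ.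
  obtain ⟨t, ht, rfl⟩ := hspec (essentialSpectrum_subset_spectrum _ hz)
  refine ⟨t, ⟨ht.1, ?_⟩, rfl⟩
  by_contra hcon
  exact hz (P.isFredholm_of_volume_ge hh (by positivity) (fun x hx => hvol x hx h hh hh₀)
    (not_le.1 hcon))

end MetropolisSetting

end

noncomputable section

/-! ### Lower bounds of the volume of `Ω ∩ B(x, r)` -/

open scoped Topology

/-- Lipschitz maps between spaces of the same finite dimension control Haar measures. -/
theorem exists_forall_measure_image_le {E F : Type*} [NormedAddCommGroup E] [NormedSpace ℝ E]
    [FiniteDimensional ℝ E] [MeasurableSpace E] [BorelSpace E] [NormedAddCommGroup F]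
    [NormedSpace ℝ F] [FiniteDimensional ℝ F] [MeasurableSpace F] [BorelSpace F]
    (μ : Measure E) [μ.IsAddHaarMeasure] (ν : Measure F) [ν.IsAddHaarMeasure]
    (hdim : Module.finrank ℝ E = Module.finrank ℝ F) :
    ∃ C : ℝ≥0, ∀ (K : ℝ≥0) (f : E → F) (s : Set E), LipschitzOnWith K f s →
      ν (f '' s) ≤ C * K ^ Module.finrank ℝ E * μ s := by
  set n := Module.finrank ℝ E with hn
  -- Each Haar measure is proportional to the n-dimensional Hausdorff measure, which a K-Lipschitz
  -- map multiplies by at most K^n.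
  have h1 : (Measure.hausdorffMeasure n : Measure E) = _ :=
    Measure.isAddLeftInvariant_eq_smul (Measure.hausdorffMeasure n : Measure E) μ
  have : (Measure.hausdorffMeasure n : Measure F).IsAddHaarMeasure := by
    rw [hdim]; infer_instance
  have h2 : ν = _ := Measure.isAddLeftInvariant_eq_smul ν (Measure.hausdorffMeasure n : Measure F)
  set a := (Measure.hausdorffMeasure n : Measure E).addHaarScalarFactor μ
  set b := ν.addHaarScalarFactor (Measure.hausdorffMeasure n : Measure F)
  refine ⟨b * a, fun K f s hf => ?_⟩
  have h3 := hf.hausdorffMeasure_image_le (d := n) (by positivity)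
  rw [h1, ENNReal.rpow_natCast] at h3
  rw [h2]
  simp only [Measure.smul_apply, ENNReal.smul_def, smul_eq_mul] at h3 ⊢
  calc (b : ℝ≥0∞) * _ ≤ b * (K ^ n * (a * μ s)) := by gcongr
    _ = _ := by push_cast; ring

/-- The volume of `Ω ∩ B(x, r)` is at least `c r ^ s`, uniformly for `x ∈ A ∩ Ω` and small `r`. -/
def HasVolumeLowerBound {X : Type*} [PseudoMetricSpace X] [MeasureSpace X] (Ω A : Set X) (s : ℝ) :
    Prop :=
  ∃ c : ℝ, 0 < c ∧ ∃ r₀ : ℝ, 0 < r₀ ∧ ∀ x ∈ A ∩ Ω, ∀ r : ℝ, 0 < r → r ≤ r₀ →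
    c * r ^ s ≤ volume.real (Ω ∩ Metric.ball x r)

theorem HasVolumeLowerBound.mono_exponent {X : Type*} [PseudoMetricSpace X] [MeasureSpace X]
    {Ω A : Set X} {s t : ℝ} (h : HasVolumeLowerBound Ω A s) (hst : s ≤ t) :
    HasVolumeLowerBound Ω A t := by
  obtain ⟨c, hc, r₀, hr₀, H⟩ := h
  refine ⟨c, hc, min r₀ 1, lt_min hr₀ one_pos, fun x hx r hr hr1 => ?_⟩
  refine le_trans ?_ (H x hx r hr (hr1.trans (min_le_left _ _)))
  exact mul_le_mul_of_nonneg_left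
    (Real.rpow_le_rpow_of_exponent_ge hr (hr1.trans (min_le_right _ _)) hst) hc.le

theorem HasVolumeLowerBound.union {X : Type*} [PseudoMetricSpace X] [MeasureSpace X]
    {Ω A B : Set X} {s : ℝ} (hA : HasVolumeLowerBound Ω A s) (hB : HasVolumeLowerBound Ω B s) :
    HasVolumeLowerBound Ω (A ∪ B) s := by
  obtain ⟨c, hc, r₀, hr₀, H⟩ := hA
  obtain ⟨c', hc', r₀', hr₀', H'⟩ := hB
  refine ⟨min c c', lt_min hc hc', min r₀ r₀', lt_min hr₀ hr₀', fun x hx r hr hr1 => ?_⟩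
  rcases hx.1 with h | h
  · exact (mul_le_mul_of_nonneg_right (min_le_left _ _) (by positivity)).trans
      (H x ⟨h, hx.2⟩ r hr (hr1.trans (min_le_left _ _)))
  · exact (mul_le_mul_of_nonneg_right (min_le_right _ _) (by positivity)).trans
      (H' x ⟨h, hx.2⟩ r hr (hr1.trans (min_le_right _ _)))

theorem hasVolumeLowerBound_of_mem_nhds {d : ℕ} {Ω : Set (EuclideanSpace ℝ (Fin d))}
    {x : EuclideanSpace ℝ (Fin d)} (hx : Ω ∈ 𝓝 x) : ∃ U ∈ 𝓝 x, HasVolumeLowerBound Ω U d := by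
  obtain ⟨ε, hε, hb⟩ := Metric.mem_nhds_iff.1 hx
  refine ⟨Metric.ball x (ε / 2), Metric.ball_mem_nhds x (by positivity), _,
    measureReal_unit_ball_pos d, ε / 2, by positivity, fun y hy r hr hr1 => ?_⟩
  have h1 : Metric.ball y r ⊆ Ω := by
    refine (Metric.ball_subset_ball' ?_).trans hb
    have := Metric.mem_ball.1 hy.1
    linarith
  rw [inter_eq_self_of_subset_right h1, measureReal_ball_eq y hr, Real.rpow_natCast, mul_comm]

/-- Compactness of the closure makes local bounds uniform. Interior points satisfy the bound with
exponent d, which is weakened to s for small radii. -/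
theorem hasVolumeLowerBound_of_frontier {d : ℕ} {Ω : Set (EuclideanSpace ℝ (Fin d))}
    (hΩ : IsOpen Ω) (hbd : Bornology.IsBounded Ω) {s : ℝ} (hs : d ≤ s)
    (h : ∀ p ∈ frontier Ω, ∃ U ∈ 𝓝 p, HasVolumeLowerBound Ω U s) :
    HasVolumeLowerBound Ω univ s := by
  have hK : IsCompact (closure Ω) := hbd.isCompact_closure
  have h1 : HasVolumeLowerBound Ω (closure Ω) s := by
    refine hK.induction_on (p := fun A => HasVolumeLowerBound Ω A s) ?_ ?_ ?_ ?_
    · exact ⟨1, one_pos, 1, one_pos, fun x hx => absurd hx.1 (notMem_empty x)⟩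
    · rintro A B hAB ⟨c, hc, r₀, hr₀, H⟩
      exact ⟨c, hc, r₀, hr₀, fun x hx => H x ⟨hAB hx.1, hx.2⟩⟩
    · exact fun A B hA hB => hA.union hB
    · intro x hx
      by_cases hxΩ : x ∈ Ω
      · obtain ⟨U, hU, hUb⟩ := hasVolumeLowerBound_of_mem_nhds (hΩ.mem_nhds hxΩ)
        exact ⟨U, mem_nhdsWithin_of_mem_nhds hU, hUb.mono_exponent hs⟩
      · obtain ⟨U, hU, hUb⟩ := h x ⟨hx, by rwa [hΩ.interior_eq]⟩
        exact ⟨U, mem_nhdsWithin_of_mem_nhds hU, hUb⟩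
  obtain ⟨c, hc, r₀, hr₀, H⟩ := h1
  exact ⟨c, hc, r₀, hr₀, fun x hx => H x ⟨subset_closure hx.2, hx.2⟩⟩

/-- Lipschitz domains satisfy an interior cone condition. -/
theorem HasLipschitzBoundaryIn.hasVolumeLowerBound {d : ℕ} {Ω U : Set (EuclideanSpace ℝ (Fin d))}
    (h : HasLipschitzBoundaryIn Ω U) {p : EuclideanSpace ℝ (Fin d)} (hp : p ∈ frontier Ω ∩ U) :
    ∃ V ∈ 𝓝 p, HasVolumeLowerBound Ω V d := by
  obtain ⟨n, K, f, W, hn, hf, hW, hpW, hΩ⟩ := h p hp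
  obtain ⟨η, hη, hb⟩ := Metric.isOpen_iff.1 hW p hpW
  set V := volume.real (Metric.ball (0 : EuclideanSpace ℝ (Fin d)) 1) with hVdef
  have hV : 0 < V := measureReal_unit_ball_pos d
  have hK : 0 ≤ (K : ℝ) := K.2
  refine ⟨Metric.ball p (η / 2), Metric.ball_mem_nhds p (by positivity),
    (2 * (1 + K : ℝ))⁻¹ ^ d * V, by positivity, η / 2, by positivity, fun x hx r hr hr1 => ?_⟩
  have hxp := Metric.mem_ball.1 hx.1
  have hball : Metric.ball x r ⊆ W := by
    refine (Metric.ball_subset_ball' ?_).trans hb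
    linarith
  have hfx := (hΩ x (hball (Metric.mem_ball_self hr))).1 hx.2
  set δ := (2 * (1 + K : ℝ))⁻¹ * r with hδ
  have hδ0 : 0 < δ := by positivity
  have hδK : δ * (1 + K) = r / 2 := by rw [hδ]; field_simp
  -- Moving up by r/2 raises the height above the graph by r/2, and a further displacement w lowers
  -- it by at most (1 + K)‖w‖ < (1 + K) δ = r/2.
  have hsub : Metric.ball (x + (r / 2) • n) δ ⊆ Ω ∩ Metric.ball x r := by
    intro y hy
    have hy' : ‖y - (x + (r / 2) • n)‖ < δ := by rwa [Metric.mem_ball, dist_eq_norm] at hy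
    set w := y - (x + (r / 2) • n) with hw
    have hyw : y = x + (r / 2) • n + w := by rw [hw]; abel
    have hyr : y ∈ Metric.ball x r := by
      rw [Metric.mem_ball, dist_eq_norm, hyw, add_assoc, add_sub_cancel_left]
      calc ‖(r / 2) • n + w‖ ≤ ‖(r / 2) • n‖ + ‖w‖ := norm_add_le _ _
        _ < r / 2 + δ := by
          rw [norm_smul, hn, mul_one, Real.norm_of_nonneg (by positivity)]
          linarith
        _ ≤ r := by nlinarith
    refine ⟨(hΩ y (hball hyr)).2 ?_, hyr⟩
    set π := (Submodule.span ℝ {n})ᗮ.orthogonalProjectionOnto with hπ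
    have hπn : π n = 0 := by
      apply Submodule.orthogonalProjectionOnto_apply_of_mem_orthogonal
      rw [Submodule.orthogonal_orthogonal]
      exact Submodule.mem_span_singleton_self n
    have hπy : π y = π x + π w := by
      rw [hyw, map_add, map_add, map_smul, hπn, smul_zero, add_zero]
    have hπw : ‖π w‖ ≤ ‖w‖ := Submodule.norm_orthogonalProjectionOnto_apply_le _ w
    have h1 : f (π y) ≤ f (π x) + K * ‖w‖ := by
      have h2 := hf.dist_le_mul (π y) (π x)
      rw [Real.dist_eq, dist_eq_norm, hπy, add_sub_cancel_left] at h2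
      have h3 := le_abs_self (f (π x + π w) - f (π x))
      have h4 : (K : ℝ) * ‖π w‖ ≤ K * ‖w‖ := mul_le_mul_of_nonneg_left hπw hK
      rw [hπy]
      linarith
    have h5 : inner ℝ n y = inner ℝ n x + r / 2 + inner ℝ n w := by
      rw [hyw, inner_add_right, inner_add_right, inner_smul_right, real_inner_self_eq_norm_sq, hn]
      ring
    have h6 : -‖w‖ ≤ inner ℝ n w := by
      have := abs_real_inner_le_norm n w
      rw [hn, one_mul] at this
      exact neg_le_of_abs_le this
    rw [h5]
    nlinarith
  calc (2 * (1 + K : ℝ))⁻¹ ^ d * V * r ^ (d : ℝ) = δ ^ d * V := by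
        rw [Real.rpow_natCast, hδ, mul_pow]; ring
    _ = volume.real (Metric.ball (x + (r / 2) • n) δ) := (measureReal_ball_eq _ hδ0).symm
    _ ≤ _ := measureReal_mono hsub (measure_inter_lt_top_of_right_ne_top measure_ball_lt_top.ne).ne

end

noncomputable section

/-! ### Volume in cusps -/

open scoped Topology

theorem le_measureReal_of_box_subset {d' d'' : ℕ} {α k t : ℝ} (hk : 0 < k) (ht : 0 < t)
    {A : Set (ℝ × EuclideanSpace ℝ (Fin d') × EuclideanSpace ℝ (Fin d''))} (hA : volume A ≠ ∞)
    {a b s' s'' : ℝ} {v' : EuclideanSpace ℝ (Fin d')} {v'' : EuclideanSpace ℝ (Fin d'')}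
    (hab : k * t ≤ b - a) (hs' : k * t ^ α ≤ s') (hs'' : k * t ≤ s'')
    (hsub : Ioo a b ×ˢ (Metric.ball v' s' ×ˢ Metric.ball v'' s'') ⊆ A) :
    k ^ (1 + d' + d'') * volume.real (Metric.ball (0 : EuclideanSpace ℝ (Fin d')) 1) *
      volume.real (Metric.ball (0 : EuclideanSpace ℝ (Fin d'')) 1) * t ^ (1 + α * d' + d'') ≤
      volume.real A := by
  have ht' : 0 < t ^ α := Real.rpow_pos_of_pos ht _
  have hs0 : 0 ≤ s' := (mul_pos hk ht').le.trans hs'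
  have h1 : volume.real (Ioo a b ×ˢ (Metric.ball v' s' ×ˢ Metric.ball v'' s'')) =
      (b - a) * (s' ^ d' * volume.real (Metric.ball (0 : EuclideanSpace ℝ (Fin d')) 1) *
        (s'' ^ d'' * volume.real (Metric.ball (0 : EuclideanSpace ℝ (Fin d'')) 1))) := by
    rw [Measure.volume_eq_prod, measureReal_prod_prod, Measure.volume_eq_prod,
      measureReal_prod_prod, Real.volume_real_Ioo_of_le (by nlinarith [mul_pos hk ht]),
      measureReal_ball_eq _ (by nlinarith [mul_pos hk ht'] : 0 < s'),
      measureReal_ball_eq _ (by nlinarith [mul_pos hk ht] : 0 < s'')]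
  refine le_trans ?_ (measureReal_mono hsub hA)
  rw [h1]
  have h2 : t ^ (1 + α * d' + d'') = t * (t ^ α) ^ d' * t ^ d'' := by
    rw [Real.rpow_add ht, Real.rpow_add ht, Real.rpow_one, Real.rpow_natCast, Real.rpow_mul ht.le,
      Real.rpow_natCast]
  calc _ = (k * t) * ((k * t ^ α) ^ d' * volume.real (Metric.ball (0 : EuclideanSpace ℝ (Fin d')) 1)
        * ((k * t) ^ d'' * volume.real (Metric.ball (0 : EuclideanSpace ℝ (Fin d'')) 1))) := by
        rw [h2]; ring
    _ ≤ _ := by gcongr; exact (mul_pos hk ht).le.trans hab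

/-- A point of the closed R-ball, possibly next to its boundary, is pulled towards the centre to
make room for a ball of radius θR that remains close to it. -/
theorem mem_ball_shrink {E : Type*} [NormedAddCommGroup E] [NormedSpace ℝ E] {x y : E} {θ R : ℝ}
    (hθ : 0 ≤ θ) (hθ1 : θ ≤ 1) (hx : ‖x‖ ≤ R) (hy : y ∈ Metric.ball ((1 - θ) • x) (θ * R)) :
    ‖y‖ < R ∧ dist y x < 2 * (θ * R) := by
  have hy' := Metric.mem_ball.1 hy
  constructor
  · calc ‖y‖ = ‖(y - (1 - θ) • x) + (1 - θ) • x‖ := by rw [sub_add_cancel]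
      _ ≤ dist y ((1 - θ) • x) + ‖(1 - θ) • x‖ := by rw [dist_eq_norm]; exact norm_add_le _ _
      _ < θ * R + (1 - θ) * R := by
        rw [norm_smul, Real.norm_of_nonneg (by linarith)]
        exact add_lt_add_of_lt_of_le hy' (mul_le_mul_of_nonneg_left hx (by linarith))
      _ = R := by ring
  · calc dist y x ≤ dist y ((1 - θ) • x) + dist ((1 - θ) • x) x := dist_triangle _ _ _
      _ < θ * R + θ * R := by
        refine add_lt_add_of_lt_of_le hy' ?_
        rw [dist_eq_norm, sub_smul, one_smul, sub_sub_cancel_left, norm_neg, norm_smul,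
          Real.norm_of_nonneg hθ]
        exact mul_le_mul_of_nonneg_left hx hθ
      _ = _ := by ring

theorem mem_ball_prod {X Y Z : Type*} [PseudoMetricSpace X] [PseudoMetricSpace Y]
    [PseudoMetricSpace Z] {x y : X × Y × Z} {t : ℝ} (h1 : dist y.1 x.1 < t)
    (h2 : dist y.2.1 x.2.1 < t) (h3 : dist y.2.2 x.2.2 < t) : y ∈ Metric.ball x t := by
  rw [Metric.mem_ball, Prod.dist_eq, Prod.dist_eq]
  exact max_lt h1 (max_lt h2 h3)

/-- A box of sizes t, t^α, t in the three groups of variables, up to constants, fits in the cusp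
near any of its points. Near the tip it is placed farther along x₁, where the cusp widens. Away from
the tip x₁ could approach ε, so the box is placed towards the tip, after shrinking x' to compensate
for the narrowing. -/
theorem modelCusp_hasVolumeLowerBound (d' d'' : ℕ) {α R ε : ℝ} (hα : 1 < α) (hR : 0 < R)
    (hε : 0 < ε) :
    HasVolumeLowerBound (modelCusp d' d'' α R ε) univ (1 + α * d' + d'') := by
  have hα0 : 0 < α := by linarith
  have hεα : 0 < ε ^ α := by positivity
  -- The summands ensure respectively that x₁ moves by less than t, that x' moves by less than t,
  -- and that the factor 1 - 4ακt is nonnegative.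
  set κ : ℝ := (2 * ε + 6 * α * ε ^ α + 4 * α)⁻¹ with hκ
  have hden : 0 < 2 * ε + 6 * α * ε ^ α + 4 * α := by positivity
  have hκ0 : 0 < κ := by positivity
  have hκ1 : κ * (2 * ε + 6 * α * ε ^ α + 4 * α) = 1 := inv_mul_cancel₀ hden.ne'
  have hκa : κ * (2 * ε) < 1 := by
    rw [← hκ1]; apply mul_lt_mul_of_pos_left _ hκ0
    nlinarith [mul_pos hα0 hεα]
  have hκb : κ * (6 * α * ε ^ α) < 1 := by
    rw [← hκ1]; apply mul_lt_mul_of_pos_left _ hκ0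
    nlinarith [mul_pos hα0 hεα]
  have hκc : κ * (4 * α) ≤ 1 := by
    rw [← hκ1]; apply mul_le_mul_of_nonneg_left _ hκ0.le
    nlinarith [mul_pos hα0 hεα]
  -- The first two entries serve the box near the tip, the last two the box away from it; 1/4 also
  -- handles x'' in both cases.
  set k : ℝ := min (min (4⁻¹) ((4⁻¹ : ℝ) ^ α)) (min (κ * (ε / 2)) (2 * α * κ * (ε / 2) ^ α)) with hk
  have hk0 : 0 < k := by
    refine lt_min (lt_min (by norm_num) (by positivity)) (lt_min (by positivity) (by positivity))
  have hk1 : k ≤ 4⁻¹ := (min_le_left _ _).trans (min_le_left _ _)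
  have hk2 : k ≤ (4⁻¹ : ℝ) ^ α := (min_le_left _ _).trans (min_le_right _ _)
  have hk3 : k ≤ κ * (ε / 2) := (min_le_right _ _).trans (min_le_left _ _)
  have hk4 : k ≤ 2 * α * κ * (ε / 2) ^ α := (min_le_right _ _).trans (min_le_right _ _)
  refine ⟨_, mul_pos (mul_pos (pow_pos hk0 (1 + d' + d'')) (measureReal_unit_ball_pos d'))
    (measureReal_unit_ball_pos d''), min (min 1 (ε / 2)) (4 * R), by positivity, ?_⟩
  rintro ⟨x1, x', x''⟩ ⟨-, hx⟩ t ht htr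
  obtain ⟨hx1, hxε, hx', hx''⟩ := hx
  dsimp only at hx1 hxε hx' hx''
  have ht1 : t ≤ 1 := htr.trans ((min_le_left _ _).trans (min_le_left _ _))
  have htε : t ≤ ε / 2 := htr.trans ((min_le_left _ _).trans (min_le_right _ _))
  have htR : t ≤ 4 * R := htr.trans (min_le_right _ _)
  have htα : t ^ α ≤ t := by
    simpa using Real.rpow_le_rpow_of_exponent_ge ht ht1 hα.le
  have hfin : volume (modelCusp d' d'' α R ε ∩ Metric.ball (x1, x', x'') t) ≠ ∞ :=
    (measure_inter_lt_top_of_right_ne_top measure_ball_lt_top.ne).ne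
  have hθ : t / (4 * R) ≤ 1 := (div_le_one (by positivity)).2 htR
  have hθ0 : 0 ≤ t / (4 * R) := by positivity
  have hθR : t / (4 * R) * R = t / 4 := by field_simp
  by_cases hcase : x1 < ε / 2
  · refine le_measureReal_of_box_subset hk0 ht hfin (a := x1 + t / 4) (b := x1 + t / 2)
      (s' := (t / 4) ^ α) (v' := x') (s'' := t / (4 * R) * R) (v'' := (1 - t / (4 * R)) • x'')
      (by nlinarith) ?_ (by rw [hθR]; nlinarith) ?_
    · rw [div_eq_inv_mul, Real.mul_rpow (by norm_num) ht.le]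
      gcongr
    · rintro ⟨y1, y', y''⟩ ⟨⟨hy1, hy1'⟩, hy', hy''⟩
      dsimp only at hy1 hy1' hy' hy''
      obtain ⟨h1, h2⟩ := mem_ball_shrink hθ0 hθ hx''.le hy''
      rw [hθR] at h2
      have hy'd := Metric.mem_ball.1 hy'
      have h3 : (t / 4) ^ α ≤ t / 4 := by
        simpa using Real.rpow_le_rpow_of_exponent_ge (by positivity : 0 < t / 4)
          (by linarith) hα.le
      refine ⟨⟨by dsimp only; linarith, by dsimp only; linarith, ?_, h1⟩,
        mem_ball_prod ?_ ?_ ?_⟩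
      · calc ‖y'‖ ≤ ‖x'‖ + dist y' x' := by
              rw [dist_eq_norm, add_comm]
              simpa using norm_add_le (y' - x') x'
          _ < x1 ^ α + (t / 4) ^ α := add_lt_add hx' hy'd
          -- Superadditivity of s ↦ s^α for α ≥ 1.
          _ ≤ (x1 + t / 4) ^ α :=
            Real.add_rpow_le_rpow_add hx1.le (by positivity) hα.le
          _ ≤ y1 ^ α := Real.rpow_le_rpow (by positivity) hy1.le hα0.le
      · dsimp only
        rw [Real.dist_eq, abs_of_pos] <;> linarith
      · dsimp only; linarith
      · dsimp only; linarith
  · rw [not_lt] at hcase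
    have hx1α : x1 ^ α ≤ ε ^ α := Real.rpow_le_rpow hx1.le hxε.le hα0.le
    have hx1α0 : 0 < x1 ^ α := by positivity
    have hεx : (ε / 2) ^ α ≤ x1 ^ α := Real.rpow_le_rpow (by positivity) hcase hα0.le
    have hκt : 0 < κ * t := by positivity
    have hκt1 : κ * t * (4 * α) ≤ 1 := by
      calc κ * t * (4 * α) = κ * (4 * α) * t := by ring
        _ ≤ 1 * 1 := mul_le_mul hκc ht1 ht.le zero_le_one
        _ = 1 := one_mul 1
    have hκt2 : κ * t * 4 ≤ 1 := by nlinarith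
    have hσ : (1 - 4 * α * (κ * t)) * x1 ^ α + 2 * α * (κ * t) * x1 ^ α =
      (1 - 2 * α * (κ * t)) * x1 ^ α := by ring
    refine le_measureReal_of_box_subset hk0 ht hfin (a := (1 - 2 * (κ * t)) * x1)
      (b := (1 - κ * t) * x1)
      (s' := 2 * α * (κ * t) * x1 ^ α) (v' := (1 - 4 * α * (κ * t)) • x')
      (s'' := t / (4 * R) * R) (v'' := (1 - t / (4 * R)) • x'') ?_ ?_
      (by rw [hθR]; nlinarith) ?_
    · calc k * t ≤ κ * (ε / 2) * t := by gcongr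
        _ ≤ κ * x1 * t := by gcongr
        _ = _ := by ring
    · calc k * t ^ α ≤ (2 * α * κ * (ε / 2) ^ α) * t := by gcongr
        _ ≤ (2 * α * κ * x1 ^ α) * t := by gcongr
        _ = _ := by ring
    · rintro ⟨y1, y', y''⟩ ⟨⟨hy1, hy1'⟩, hy', hy''⟩
      dsimp only at hy1 hy1' hy' hy''
      obtain ⟨h1, h2⟩ := mem_ball_shrink hθ0 hθ hx''.le hy''
      rw [hθR] at h2
      have hy'd := Metric.mem_ball.1 hy'
      have hv' : ‖(1 - 4 * α * (κ * t)) • x'‖ ≤ (1 - 4 * α * (κ * t)) * x1 ^ α := by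
        rw [norm_smul, Real.norm_of_nonneg (by linarith)]
        exact mul_le_mul_of_nonneg_left hx'.le (by linarith)
      have hy1pos : 0 ≤ (1 - 2 * (κ * t)) * x1 := mul_nonneg (by linarith) hx1.le
      have hκtx : κ * t * x1 ≤ κ * t * ε := by gcongr
      have hκtε : 2 * (κ * t * ε) < t := by
        have := mul_lt_mul_of_pos_right hκa ht
        linarith
      have hκtx0 : 0 < κ * t * x1 := by positivity
      have e1 : (1 - 2 * (κ * t)) * x1 = x1 - 2 * (κ * t * x1) := by ring
      have e2 : (1 - κ * t) * x1 = x1 - κ * t * x1 := by ring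
      have h4κ : 0 ≤ 1 - 4 * α * (κ * t) := by linarith
      have h2κ : 0 ≤ 1 - 2 * (κ * t) := by linarith
      refine ⟨⟨by dsimp only; linarith, by dsimp only; linarith, ?_, h1⟩,
        mem_ball_prod ?_ ?_ ?_⟩
      -- Bernoulli's inequality: multiplying x₁ by 1 - 2κt shrinks the section by a factor no
      -- smaller than 1 - 2ακt, while y' has norm less than (1 - 2ακt) x₁^α.
      · have hbern : 1 - 2 * α * (κ * t) ≤ (1 - 2 * (κ * t)) ^ α := by
          have := one_add_mul_self_le_rpow_one_add (s := -(2 * (κ * t))) (by linarith) hα.le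
          rw [← sub_eq_add_neg] at this
          linarith
        calc ‖y'‖ ≤ ‖(1 - 4 * α * (κ * t)) • x'‖ + dist y' ((1 - 4 * α * (κ * t)) • x') := by
              rw [dist_eq_norm, add_comm]
              simpa using norm_add_le (y' - (1 - 4 * α * (κ * t)) • x')
                ((1 - 4 * α * (κ * t)) • x')
          _ < (1 - 4 * α * (κ * t)) * x1 ^ α + 2 * α * (κ * t) * x1 ^ α :=
            add_lt_add_of_le_of_lt hv' hy'd
          _ = (1 - 2 * α * (κ * t)) * x1 ^ α := hσ
          _ ≤ (1 - 2 * (κ * t)) ^ α * x1 ^ α := by gcongr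
          _ = ((1 - 2 * (κ * t)) * x1) ^ α := by rw [Real.mul_rpow h2κ hx1.le]
          _ ≤ y1 ^ α := Real.rpow_le_rpow hy1pos hy1.le hα0.le
      · dsimp only
        rw [Real.dist_eq, abs_lt]
        constructor <;> linarith
      · dsimp only
        have h5 : dist ((1 - 4 * α * (κ * t)) • x') x' ≤ 4 * α * (κ * t) * x1 ^ α := by
          rw [dist_eq_norm, sub_smul, one_smul, sub_sub_cancel_left, norm_neg, norm_smul,
            Real.norm_of_nonneg (by positivity)]
          gcongr
        have h6 : 6 * α * (κ * t) * x1 ^ α ≤ 6 * α * (κ * t) * ε ^ α := by gcongr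
        have h7 : 6 * α * (κ * t) * ε ^ α < t := by
          have := mul_lt_mul_of_pos_right hκb ht
          linarith
        have := dist_triangle y' ((1 - 4 * α * (κ * t)) • x') x'
        linarith
      · dsimp only; linarith

end

/-! ### Transport through cusp charts, and conclusion -/

noncomputable section

open scoped Topology

/-- Volume lower bounds pass through charts which are smooth together with their inverse. -/
theorem IsCuspChart.hasVolumeLowerBound {d d' d'' : ℕ} {Ω U : Set (EuclideanSpace ℝ (Fin d))}
    {α R ε : ℝ} {q : EuclideanSpace ℝ (Fin d)}
    {φ : OpenPartialHomeomorph (EuclideanSpace ℝ (Fin d))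
      (ℝ × EuclideanSpace ℝ (Fin d') × EuclideanSpace ℝ (Fin d''))}
    (h : IsCuspChart Ω U α R ε q φ) (hU : IsOpen U) (hdim : 1 + d' + d'' = d) (hα : 1 < α)
    (hR : 0 < R) (hε : 0 < ε) {p : EuclideanSpace ℝ (Fin d)} (hpU : p ∈ U) (hp : p ∈ φ.source) :
    ∃ V ∈ 𝓝 p, HasVolumeLowerBound Ω V (1 + α * d' + d'') := by
  -- The model bound is uniform over the whole cusp, so p may be any point of the chart domain in U,
  -- not only the centre q.
  obtain ⟨c, hc, r₀, hr₀, H⟩ := modelCusp_hasVolumeLowerBound d' d'' hα hR hε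
  set s : ℝ := 1 + α * d' + d''
  have : (volume : Measure (EuclideanSpace ℝ (Fin d') ×
      EuclideanSpace ℝ (Fin d''))).IsAddHaarMeasure := Measure.prod.instIsAddHaarMeasure _ _
  have : (volume : Measure (ℝ × EuclideanSpace ℝ (Fin d') ×
      EuclideanSpace ℝ (Fin d''))).IsAddHaarMeasure := Measure.prod.instIsAddHaarMeasure _ _
  obtain ⟨C, hC⟩ := exists_forall_measure_image_le
    (volume : Measure (EuclideanSpace ℝ (Fin d)))
    (volume : Measure (ℝ × EuclideanSpace ℝ (Fin d') × EuclideanSpace ℝ (Fin d'')))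
    (by simp [Module.finrank_prod]; omega)
  rw [finrank_euclideanSpace_fin] at hC
  have hφ : ContDiffAt ℝ 1 φ p :=
    ((h.contDiffOn.contDiffAt (φ.open_source.mem_nhds hp))).of_le (by exact_mod_cast le_top)
  have hψ : ContDiffAt ℝ 1 φ.symm (φ p) :=
    ((h.contDiffOn_symm.contDiffAt (φ.open_target.mem_nhds (φ.map_source hp)))).of_le
      (by exact_mod_cast le_top)
  obtain ⟨K, A, hA, hK⟩ := hφ.exists_lipschitzOnWith
  obtain ⟨L', B, hB, hL'⟩ := hψ.exists_lipschitzOnWith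
  -- L ≥ 1 guarantees that the model radius t = r / L is at most r.
  set L : ℝ≥0 := max L' 1
  have hL : LipschitzOnWith L φ.symm B := hL'.weaken (le_max_left _ _)
  have hL1 : (1 : ℝ) ≤ L := by exact_mod_cast le_max_right L' 1
  obtain ⟨η, hη, hηA⟩ := Metric.mem_nhds_iff.1
    (inter_mem hA (inter_mem (φ.open_source.mem_nhds hp) (hU.mem_nhds hpU)))
  obtain ⟨η', hη', hηB⟩ := Metric.mem_nhds_iff.1
    (inter_mem hB (φ.open_target.mem_nhds (φ.map_source hp)))
  have hcont : ContinuousAt φ p := φ.continuousAt hp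
  refine ⟨Metric.ball p (η / 2) ∩ φ ⁻¹' Metric.ball (φ p) (η' / 2),
    inter_mem (Metric.ball_mem_nhds p (by positivity))
      (hcont.preimage_mem_nhds (Metric.ball_mem_nhds _ (by positivity))),
    (C * K ^ d + 1 : ℝ)⁻¹ * c * (L : ℝ)⁻¹ ^ s, by positivity, min r₀ (min (η / 2) (η' / 2)),
    by positivity, ?_⟩
  rintro x ⟨⟨hxp, hxφ⟩, hxΩ⟩ r hr hr1
  have hrr₀ : r ≤ r₀ := hr1.trans (min_le_left _ _)
  have hrη : r ≤ η / 2 := hr1.trans ((min_le_right _ _).trans (min_le_left _ _))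
  have hrη' : r ≤ η' / 2 := hr1.trans ((min_le_right _ _).trans (min_le_right _ _))
  rw [Metric.mem_ball] at hxp
  rw [mem_preimage, Metric.mem_ball] at hxφ
  have hball : Metric.ball x r ⊆ Metric.ball p η := Metric.ball_subset_ball' (by linarith)
  have hx := hηA (hball (Metric.mem_ball_self hr))
  have hcusp : φ x ∈ modelCusp d' d'' α R ε := (h.mem_iff x hx.2.1).1 ⟨hxΩ, hx.2.2⟩
  set t : ℝ := (L : ℝ)⁻¹ * r with ht
  have hL0 : (0 : ℝ) < L := by linarith
  have ht0 : 0 < t := by positivity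
  have htr : t ≤ r := by
    rw [ht, inv_mul_le_iff₀ hL0]; nlinarith
  have hvol := H (φ x) ⟨mem_univ _, hcusp⟩ t ht0 (htr.trans hrr₀)
  -- The Lipschitz bound of the inverse chart brings the model ball back into B(x,r); the Lipschitz
  -- bound of φ then compares the volumes.
  have hsub : modelCusp d' d'' α R ε ∩ Metric.ball (φ x) t ⊆ φ '' (Ω ∩ Metric.ball x r) := by
    rintro y ⟨hyC, hy⟩
    have hyB : y ∈ Metric.ball (φ p) η' := Metric.ball_subset_ball' (by linarith) hy
    have hyB' := hηB hyB
    have hxB' := hηB (Metric.ball_subset_ball' (x := φ x) (ε₁ := t) (by linarith)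
      (Metric.mem_ball_self ht0))
    have hdist : dist (φ.symm y) x < r := by
      have h1 := hL.dist_le_mul y hyB'.1 (φ x) hxB'.1
      rw [φ.left_inv hx.2.1] at h1
      refine h1.trans_lt ?_
      calc (L : ℝ) * dist y (φ x) < L * t := mul_lt_mul_of_pos_left (Metric.mem_ball.1 hy) hL0
        _ = r := by rw [ht, mul_inv_cancel_left₀ hL0.ne']
    have hyW := hηA (hball (Metric.mem_ball.2 hdist))
    refine ⟨φ.symm y, ⟨((h.mem_iff _ hyW.2.1).2 ?_).1, hdist⟩, φ.right_inv hyB'.2⟩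
    rwa [φ.right_inv hyB'.2]
  have hfin : volume (Ω ∩ Metric.ball x r) ≠ ∞ :=
    (measure_inter_lt_top_of_right_ne_top measure_ball_lt_top.ne).ne
  have hle := hC K φ (Ω ∩ Metric.ball x r)
    (hK.mono fun y hy => (hηA (hball hy.2)).1)
  have hle' := (measure_mono hsub).trans hle
  have hle2 := ENNReal.toReal_mono
    (ENNReal.mul_ne_top (ENNReal.mul_ne_top ENNReal.coe_ne_top
      (ENNReal.pow_ne_top ENNReal.coe_ne_top)) hfin) hle'
  rw [ENNReal.toReal_mul, ENNReal.toReal_mul, ENNReal.toReal_pow, ENNReal.coe_toReal,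
    ENNReal.coe_toReal, ← measureReal_def, ← measureReal_def] at hle2
  have hfinal : c * t ^ s ≤ (C * K ^ d + 1) * volume.real (Ω ∩ Metric.ball x r) :=
    (hvol.trans hle2).trans (mul_le_mul_of_nonneg_right (by linarith) measureReal_nonneg)
  -- The added 1 avoids a separate proof that C K^d is nonzero before dividing.
  have hpos : (0 : ℝ) < C * K ^ d + 1 := by positivity
  calc (C * K ^ d + 1 : ℝ)⁻¹ * c * (L : ℝ)⁻¹ ^ s * r ^ s = (C * K ^ d + 1 : ℝ)⁻¹ * (c * t ^ s) := by
        rw [ht, Real.mul_rpow (by positivity) hr.le]; ring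
    _ ≤ _ := by rw [inv_mul_le_iff₀ hpos]; exact hfinal

/-- The case without cusps is included, the real supremum of an empty family being 0. -/
theorem CuspidalBoundary.γ_nonneg {d : ℕ} {Ω : Set (EuclideanSpace ℝ (Fin d))}
    (A : CuspidalBoundary Ω) : 0 ≤ A.γ :=
  Real.iSup_nonneg fun i => mul_nonneg (by linarith [A.one_lt_α i]) (Nat.cast_nonneg _)

theorem CuspidalBoundary.le_γ {d : ℕ} {Ω : Set (EuclideanSpace ℝ (Fin d))}
    (A : CuspidalBoundary Ω) (i : Fin A.nc) : (A.α i - 1) * (A.d' i : ℝ) ≤ A.γ :=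
  le_ciSup (f := fun i => (A.α i - 1) * (A.d' i : ℝ)) (finite_range _).bddAbove i

/-- Since d = 1 + d' + d'', the cusp exponent 1 + α d' + d'' equals d + (α - 1) d', which is at most
d + γ. -/
theorem CuspidalBoundary.hasVolumeLowerBound {d : ℕ} {Ω : Set (EuclideanSpace ℝ (Fin d))}
    (A : CuspidalBoundary Ω) (hΩ : IsOpen Ω) (hbd : Bornology.IsBounded Ω) :
    HasVolumeLowerBound Ω univ (d + A.γ) := by
  refine hasVolumeLowerBound_of_frontier hΩ hbd (by linarith [A.γ_nonneg]) fun p hp => ?_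
  rcases A.cover hp with h | h
  · obtain ⟨i, hi⟩ := mem_iUnion.1 h
    obtain ⟨V, hV, hVb⟩ := (A.lipschitz i).hasVolumeLowerBound ⟨hp, hi⟩
    exact ⟨V, hV, hVb.mono_exponent (by linarith [A.γ_nonneg])⟩
  · obtain ⟨i, hi⟩ := mem_iUnion.1 h
    obtain ⟨q, hq⟩ := mem_iUnion.1 (A.chart_cover i ⟨hp, hi⟩)
    obtain ⟨V, hV, hVb⟩ := (A.isCuspChart i q).hasVolumeLowerBound (A.isOpen_Uc i) (A.dim_eq i)
      (A.one_lt_α i) (A.r_pos i) (A.ε_pos i) hi hq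
    refine ⟨V, hV, hVb.mono_exponent ?_⟩
    have h1 : (d : ℝ) = 1 + A.d' i + A.d'' i := by rw [← Nat.cast_one]; exact_mod_cast (A.dim_eq i).symm
    have h2 := A.le_γ i
    rw [h1]
    linarith

end

theorem proposition1p3 {d : ℕ} (P : MetropolisSetting d) (A : CuspidalBoundary P.Ω) :
    ∃ δ₁ δ₂ h₀ : ℝ, 0 < δ₁ ∧ 0 < δ₂ ∧ 0 < h₀ ∧ ∀ h : ℝ, 0 < h → h ≤ h₀ →
      spectrum ℂ (P.T h) ⊆
        (fun t : ℝ => (t : ℂ)) '' Set.Icc (-1 + δ₁ * h ^ A.γ) 1 ∧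
      essentialSpectrum (P.T h) ⊆
        (fun t : ℝ => (t : ℂ)) '' Set.Icc (-1 + δ₁ * h ^ A.γ) (1 - δ₂ * h ^ A.γ) := by
  obtain ⟨c, hc, r₀, hr₀, H⟩ := A.hasVolumeLowerBound P.isOpen P.isBounded
  exact P.spectra_subset_of_forall_volume_ge hc hr₀ fun x hx => H x ⟨mem_univ x, hx⟩
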